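/- Let $a,d\in\mathbb N$ and let $X_{ik}=(X_{i1k},\dots,X_{idk})'$, $1\le i\le a$, $k\ge 1$, be independent $\mathbb R^d$-valued random vectors on a probability space $(\Omega,\mathcal A,P)$, identically distributed within each group $i$. Let $F_{ij}$ be the normalized distribution function of $X_{ij1}$ (the mean of its left- and right-continuous versions). Group $i$ has $n_i$ observations $X_{i1},\dots,X_{in_i}$; put $N=\sum_{i=1}^a n_i$ and let $\mathbf X$ be the pooled sample. Condition 1: as $N\to\infty$, $n_i/N\to\lambda_i\in(0,1)$ for every $i$. Put $c(u)=\mathbf 1\{u>0\}+\tfrac12\mathbf 1\{u=0\}$, $\widehat F_{ij}(x)=\frac1{n_i}\sum_{k=1}^{n_i}c(x-X_{ijk})$, $\widehat G_j=\frac1a\sum_{\ell=1}^a\widehat F_{\ell j}$. Let $D_{\ell k}$ ($1\le\ell\le a$, $k\ge1$) be i.i.d. real random variables on $(\Omega,\mathcal A,P)$, independent of the $X_{ik}$, with mean $0$, variance $1$ and $\int_0^\infty\sqrt{P(|D_{11}|>x)}\,dx<\infty$. Define $$F^\star_{\ell j}(x)=\frac1{n_\ell}\sum_{k=1}^{n_\ell}D_{\ell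 k}\,[c(x-X_{\ell jk})-\widehat F_{\ell j}(x)],\qquad G^\star_j=\frac1a\sum_{\ell=1}^aF^\star_{\ell j},$$ $$p^\star_{ij}=\int G^\star_j\,d\widehat F_{ij}-\int F^\star_{ij}\,d\widehat G_j,\qquad \mathbf p^\star=\sqrt N\,(p^\star_{11},p^\star_{12},\dots,p^\star_{ad})',$$ where the integrals are with respect to the corresponding empirical measures. Let $\mathbf T\in\mathbb R^{ad\times ad}$ be a symmetric idempotent matrix and $T_N^\star={\mathbf p^\star}'\mathbf T\mathbf p^\star$. Let $\boldsymbol\Sigma\in\mathbb R^{ad\times ad}$ be the matrix with entries $\Sigma_{(ij),(i'j')}=\frac1{a^2}\sum_{\ell=1}^a\sum_{\ell'=1}^a\sigma_{\ell ij,\ell'i'j'}$, where, with Kronecker's $\delta$, $$\begin{aligned}\sigma_{\ell ij,\ell'i'j'}={}&\tfrac{\delta_{\ell\ell'}}{\lambda_\ell}\operatorname{cov}(F_{ij}(X_{\ell j1}),F_{i'j'}(X_{\ell j'1}))-\tfrac{\delta_{\ell i'}}{\lambda_\ell}\operatorname{cov}(F_{ij}(X_{\ell j1}),F_{\ell'j'}(X_{\ell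 j'1}))\\&+\tfrac{\delta_{ii'}}{\lambda_i}\operatorname{cov}(F_{\ell j}(X_{ij1}),F_{\ell'j'}(X_{ij'1}))-\tfrac{\delta_{i\ell'}}{\lambda_i}\operatorname{cov}(F_{\ell j}(X_{ij1}),F_{i'j'}(X_{ij'1})).\end{aligned}$$ Suppose Condition 1 holds. Then $\boldsymbol\Sigma$ is positive semidefinite and, as $N\to\infty$, conditionally on $\mathbf X$, $$T_N^\star\ \xrightarrow{\ d\ }\ \mathbf Z'\mathbf T\mathbf Z\ \overset{d}{=}\ \sum_{h=1}^{ad}\nu_hY_h^2\quad\text{in outer probability},$$ where $\mathbf Z\sim N_{ad}(\mathbf 0,\boldsymbol\Sigma)$, $Y_1,\dots,Y_{ad}$ are independent standard normal, and $\nu_1,\dots,\nu_{ad}\ge0$ are the eigenvalues of $\boldsymbol\Sigma^{1/2}\mathbf T\boldsymbol\Sigma^{1/2}$. The convergence means that $$\sup_h\big|E[h(T_N^\star)\mid\mathbf X]-E[h(\mathbf Z'\mathbf T\mathbf Z)]\big|\to0$$ in outer probability, where the supremum is over all $h:\mathbb R\to\mathbb R$ with $|h|\le1$ and $|h(x)-h(y)|\le|x-y|$,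 and the conditional expectations are taken under a regular conditional distribution of $T_N^\star$ given $\mathbf X$. The null hypothesis $\mathbf T\mathbf p=\mathbf 0$ on the vector $\mathbf p=(p_{ij})$ of the effects $p_{ij}=\frac1a\sum_{\ell=1}^a\int F_{\ell j}\,dF_{ij}$ is not assumed. -/

import Mathlib

open MeasureTheory ProbabilityTheory Filter Topology Matrix
open scoped MatrixOrder

noncomputable section

namespace WildATS

/-! ### Empirical quantities and the wild bootstrap

`x i k j` is the `j`-th measurement of individual `k` in group `i`, `D i k` is the multiplier
attached to individual `k` in group `i`, and `n i` is the size of group `i`; individuals are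
numbered `0, …, n i - 1`. -/

/-- The normalized counting function `c(u) = 1{u > 0} + (1/2) 1{u = 0}`. -/
def c (u : ℝ) : ℝ := if 0 < u then 1 else if u = 0 then 1 / 2 else 0

variable {a d : ℕ}

/-- The normalized empirical distribution function `F̂_{ij}`. -/
def empCDF (n : Fin a → ℕ) (x : Fin a → ℕ → Fin d → ℝ) (i : Fin a) (j : Fin d) (t : ℝ) : ℝ :=
  (1 / (n i : ℝ)) * ∑ k ∈ Finset.range (n i), c (t - x i k j)

/-- The integral `∫ f dF̂_{ij}`, i.e. the average of `f` over the `j`-th components of the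
observations in group `i`. -/
def empInt (n : Fin a → ℕ) (x : Fin a → ℕ → Fin d → ℝ) (i : Fin a) (j : Fin d)
    (f : ℝ → ℝ) : ℝ :=
  (1 / (n i : ℝ)) * ∑ k ∈ Finset.range (n i), f (x i k j)

/-- The integral `∫ f dĜ_j` with `Ĝ_j = (1/a) ∑_ℓ F̂_{ℓj}`. -/
def empMeanInt (n : Fin a → ℕ) (x : Fin a → ℕ → Fin d → ℝ) (j : Fin d) (f : ℝ → ℝ) : ℝ :=
  (1 / (a : ℝ)) * ∑ l, empInt n x l j f

/-- The wild bootstrap residual `ε̂_{ℓjk}(t) = D_{ℓk} [c(t - X_{ℓjk}) - F̂_{ℓj}(t)]`. -/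
def wildResid (n : Fin a → ℕ) (x : Fin a → ℕ → Fin d → ℝ) (D : Fin a → ℕ → ℝ)
    (l : Fin a) (j : Fin d) (k : ℕ) (t : ℝ) : ℝ :=
  D l k * (c (t - x l k j) - empCDF n x l j t)

/-- `F*_{ℓj} = (1/n_ℓ) ∑_k ε̂_{ℓjk}`. -/
def wildCDF (n : Fin a → ℕ) (x : Fin a → ℕ → Fin d → ℝ) (D : Fin a → ℕ → ℝ)
    (l : Fin a) (j : Fin d) (t : ℝ) : ℝ :=
  (1 / (n l : ℝ)) * ∑ k ∈ Finset.range (n l), wildResid n x D l j k t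

/-- `G*_j = (1/a) ∑_ℓ F*_{ℓj}`. -/
def wildMeanCDF (n : Fin a → ℕ) (x : Fin a → ℕ → Fin d → ℝ) (D : Fin a → ℕ → ℝ)
    (j : Fin d) (t : ℝ) : ℝ :=
  (1 / (a : ℝ)) * ∑ l, wildCDF n x D l j t

/-- `p*_{ij} = ∫ G*_j dF̂_{ij} - ∫ F*_{ij} dĜ_j`. -/
def wildEffect (n : Fin a → ℕ) (x : Fin a → ℕ → Fin d → ℝ) (D : Fin a → ℕ → ℝ)
    (i : Fin a) (j : Fin d) : ℝ :=
  empInt n x i j (wildMeanCDF n x D j) - empMeanInt n x j (wildCDF n x D i j)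

/-- The total sample size `N = ∑_i n_i`. -/
def total (n : Fin a → ℕ) : ℕ := ∑ i, n i

/-- The vector `p* = √N (p*_{11}, p*_{12}, …, p*_{ad})'`. -/
def pStar (n : Fin a → ℕ) (x : Fin a → ℕ → Fin d → ℝ) (D : Fin a → ℕ → ℝ) :
    Fin a × Fin d → ℝ :=
  fun s => √(total n : ℝ) * wildEffect n x D s.1 s.2

/-- The quadratic form `z ↦ z' T z`. -/
def quadForm (T : Matrix (Fin a × Fin d) (Fin a × Fin d) ℝ) (z : Fin a × Fin d → ℝ) : ℝ :=
  z ⬝ᵥ (T *ᵥ z)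

/-- The wild bootstrap ANOVA-type statistic `T*_N = p*' T p*`. -/
def wildATS (T : Matrix (Fin a × Fin d) (Fin a × Fin d) ℝ)
    (n : Fin a → ℕ) (x : Fin a → ℕ → Fin d → ℝ) (D : Fin a → ℕ → ℝ) : ℝ :=
  quadForm T (pStar n x D)

/-- The pooled sample: the observations `x i k` with `k < n i`, for all groups `i`. -/
def pooled (n : Fin a → ℕ) (x : Fin a → ℕ → Fin d → ℝ) :
    ((i : Fin a) × Fin (n i)) → Fin d → ℝ :=
  fun s => x s.1 s.2

/-! ### The limit distribution

`Q i` is the distribution of an observation vector in group `i`. -/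

/-- The normalized distribution function of a law `μ` on the line: the mean of its left- and
right-continuous versions. -/
def normalizedCDF (μ : Measure ℝ) (t : ℝ) : ℝ :=
  (μ.real (Set.Iio t) + μ.real (Set.Iic t)) / 2

/-- The normalized marginal distribution function `F_{ij}`. -/
def margCDF (Q : Fin a → Measure (Fin d → ℝ)) (i : Fin a) (j : Fin d) : ℝ → ℝ :=
  normalizedCDF ((Q i).map (fun y => y j))

/-- `cov(F_{ij}(X_{r j 1}), F_{i'j'}(X_{r j' 1}))`. -/
def covF (Q : Fin a → Measure (Fin d → ℝ)) (r i : Fin a) (j : Fin d) (i' : Fin a)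
    (j' : Fin d) : ℝ :=
  cov[fun y => margCDF Q i j (y j), fun y => margCDF Q i' j' (y j'); Q r]

/-- The asymptotic covariance `σ_{ℓij, ℓ'i'j'}` of `√N ŵ_{ℓij}` and `√N ŵ_{ℓ'i'j'}`, where
`ŵ_{ℓij} = ∫ F̂_{ℓj} dF̂_{ij}` and `lam r` is the limit of `n_r / N`. -/
def sigmaW (Q : Fin a → Measure (Fin d → ℝ)) (lam : Fin a → ℝ)
    (l i : Fin a) (j : Fin d) (l' i' : Fin a) (j' : Fin d) : ℝ :=
  (if l = l' then (1 / lam l) * covF Q l i j i' j' else 0)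
    - (if l = i' then (1 / lam l) * covF Q l i j l' j' else 0)
    + (if i = i' then (1 / lam i) * covF Q i l j l' j' else 0)
    - (if i = l' then (1 / lam i) * covF Q i l j i' j' else 0)

/-- The asymptotic covariance matrix `Σ` of `√N (p̂ - p)`, where `p̂_{ij} = (1/a) ∑_ℓ ŵ_{ℓij}`. -/
def asymCov (Q : Fin a → Measure (Fin d → ℝ)) (lam : Fin a → ℝ) :
    Matrix (Fin a × Fin d) (Fin a × Fin d) ℝ :=
  fun s s' => (1 / (a : ℝ) ^ 2) * ∑ l, ∑ l', sigmaW Q lam l s.1 s.2 l' s'.1 s'.2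

theorem isHermitian_sandwich {ι : Type*} [Fintype ι] [DecidableEq ι] (S T : Matrix ι ι ℝ)
    (hT : T.IsSymm) : (CFC.sqrt S * T * CFC.sqrt S).IsHermitian := by
  have h1 : (CFC.sqrt S)ᴴ = CFC.sqrt S := (CFC.sqrt_nonneg S).posSemidef.isHermitian
  have h2 : Tᴴ = T := by rw [Matrix.conjTranspose_eq_transpose_of_trivial]; exact hT
  unfold Matrix.IsHermitian
  rw [Matrix.conjTranspose_mul, Matrix.conjTranspose_mul, h1, h2, Matrix.mul_assoc]

/-- The eigenvalues `ν_h` (with multiplicity) of `S^{1/2} T S^{1/2}`. -/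
def weights {ι : Type*} [Fintype ι] [DecidableEq ι] (S T : Matrix ι ι ℝ)
    (hT : T.IsSymm) : ι → ℝ :=
  (isHermitian_sandwich S T hT).eigenvalues

/-- The law of `Z' T Z`, where `Z` is centered Gaussian with covariance matrix `S`. -/
def gaussianQuadLaw (S T : Matrix (Fin a × Fin d) (Fin a × Fin d) ℝ) : Measure ℝ :=
  (multivariateGaussian 0 S).map (fun z => quadForm T z.ofLp)

/-- The law of `∑_h ν_h Y_h²` with `Y_h` independent standard normal. -/
def weightedChiSqLaw {ι : Type*} [Fintype ι] (ν : ι → ℝ) : Measure ℝ :=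
  (Measure.pi (fun _ : ι => gaussianReal 0 1)).map (fun y => ∑ h, ν h * y h ^ 2)

/-! ### Conditional convergence in distribution -/

/-- The bounded Lipschitz distance `sup_h |∫ h dμ - ∫ h dν|` of two probability measures on the
line, the supremum being over all `h` with `|h| ≤ 1` and `|h x - h y| ≤ |x - y|`. -/
def blDist (μ ν : Measure ℝ) : ℝ :=
  sSup {r : ℝ | ∃ h : ℝ → ℝ, LipschitzWith 1 h ∧ (∀ t, |h t| ≤ 1) ∧
    r = |∫ t, h t ∂μ - ∫ t, h t ∂ν|}

/-- Given `X m`, the real random variables `S m` converge in distribution to the law `ν` in outer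
probability: the bounded Lipschitz distance between the conditional law of `S m` given `X m` and
`ν` tends to `0` in outer probability. Measurability of that distance is not presupposed: the value
of a `Measure` on an arbitrary set is its outer measure. -/
def CondTendstoInDistribution {Ω : Type*} [MeasurableSpace Ω] (P : Measure Ω) [IsFiniteMeasure P]
    {β : ℕ → Type*} [∀ m, MeasurableSpace (β m)]
    (S : ℕ → Ω → ℝ) (X : (m : ℕ) → Ω → β m) (ν : Measure ℝ) : Prop :=
  TendstoInMeasure P (fun m ω => blDist (condDistrib (S m) (X m) P (X m ω)) ν) atTop (fun _ => 0)

end WildATS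

end

namespace WildATS

/-! ### The bounded Lipschitz distance metrizes weak convergence -/

/-! Since data and multipliers are independent, the conditional law of the statistic given the
pooled sample is its law with the sample frozen (`condDistrib_wildATS`). For a frozen sample the
bootstrap vector is linear in the multipliers: the symmetry `c (s - t) = 1 - c (t - s)` turns each
integral of `wildCDF` into a multiplier sum of centered values of empirical distribution functions
(`empInt_wildCDF`, `pStar_eq`).

The weights are at most `√N / n_r`, hence uniformly small, and their Gram matrix is the empirical
counterpart of `Σ` (`sum_wildWeight_mul`, `asymCov_eq`). A central limit theorem for weighted sums
of i.i.d. variables (`tendsto_weighted_sum_gaussian`) and continuous mapping give the Gaussian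
quadratic form along every deterministic sequence of samples whose empirical first and mixed moments
converge (`tendsto_blDist_wildATS`).

A contradiction argument makes this uniform: once those finitely many moments are within `δ` of
their limits and `m` is large, the bounded Lipschitz distance is below `ε`
(`exists_blDist_wildATS_lt`). Second moment bounds show that the moments converge in probability
(`tendsto_measure_empInt`, `tendsto_measure_empMixed`), and a union bound finishes. No null
hypothesis enters because the residuals are centered empirically.

`Σ` is positive semidefinite because its quadratic form is a positive combination of variances. The
chi-square representation is diagonalization together with rotation invariance of the standard
Gaussian. -/

theorem integral_le_of_levyProkhorovEDist_lt {μ ν : Measure ℝ} [IsProbabilityMeasure μ]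
    [IsProbabilityMeasure ν] {ε : ℝ} (hε : 0 < ε)
    (hμν : levyProkhorovEDist μ ν < ENNReal.ofReal ε) {h : ℝ → ℝ} (hL : LipschitzWith 1 h)
    (hb : ∀ t, |h t| ≤ 1) : ∫ t, h t ∂μ ≤ ∫ t, h t ∂ν + 3 * ε := by
  have hint : ∀ κ : Measure ℝ, IsProbabilityMeasure κ → Integrable h κ := fun κ _ =>
    Integrable.of_bound hL.continuous.aestronglyMeasurable 1 (ae_of_all _ hb)
  -- Shifting by 1 makes the test function nonnegative, as the layer-cake formula requires. The norm
  -- bound 2 costs `2 * ε`; raising the levels by `ε` below costs one more.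
  let f : BoundedContinuousFunction ℝ ℝ :=
    BoundedContinuousFunction.ofNormedAddCommGroup (fun t => h t + 1)
      (hL.continuous.add continuous_const) 2 (fun t => by
        have := abs_le.1 (hb t)
        rw [Real.norm_eq_abs, abs_le]; constructor <;> linarith)
  have hfv : ∀ t, f t = h t + 1 := fun t => rfl
  have hf0 : ∀ t, 0 ≤ f t := fun t => by have := abs_le.1 (hb t); rw [hfv]; linarith
  have hfn : ‖f‖ ≤ 2 := BoundedContinuousFunction.norm_ofNormedAddCommGroup_le _ (by norm_num) _
  have h1 := BoundedContinuousFunction.integral_le_of_levyProkhorovEDist_lt μ ν hε hμν f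
    (ae_of_all _ hf0)
  have hgint : Integrable (fun t => f t + ε) ν := (f.integrable ν).add (integrable_const ε)
  have h2 := hgint.integral_eq_integral_Ioc_meas_le (M := ‖f‖ + ε)
    (ae_of_all _ fun t => by have := hf0 t; simp only [Pi.zero_apply]; linarith)
    (ae_of_all _ fun t => by have := f.apply_le_norm t; simp only; linarith)
  have hanti : Antitone (fun t : ℝ => ν.real {a | t ≤ f a + ε}) := fun s t hst =>
    measureReal_mono (fun a ha => le_trans hst ha)
  have hanti' : Antitone (fun t : ℝ => ν.real (Metric.thickening ε {a | t ≤ f a})) :=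
    fun s t hst => measureReal_mono (Metric.thickening_subset_of_subset ε fun a ha => hst.trans ha)
  have hI : ∀ (g : ℝ → ℝ) (b : ℝ), Antitone g → (∀ t, 0 ≤ g t ∧ g t ≤ 1) →
      IntegrableOn g (Set.Ioc 0 b) := fun g b hg hg1 =>
    Measure.integrableOn_of_bounded (M := 1) measure_Ioc_lt_top.ne
      hg.measurable.aestronglyMeasurable
      (ae_of_all _ fun t => by rw [Real.norm_eq_abs, abs_of_nonneg (hg1 t).1]; exact (hg1 t).2)
  -- By the Lipschitz bound, a point within `ε` of `{t ≤ f}` still satisfies `t ≤ f + ε`.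
  have h3 : ∫ t in Set.Ioc 0 ‖f‖, ν.real (Metric.thickening ε {a | t ≤ f a})
      ≤ ∫ t in Set.Ioc 0 ‖f‖, ν.real {a | t ≤ f a + ε} := by
    refine setIntegral_mono (hI _ _ hanti' fun t => ⟨measureReal_nonneg, measureReal_le_one⟩)
      (hI _ _ hanti fun t => ⟨measureReal_nonneg, measureReal_le_one⟩) fun t => ?_
    refine measureReal_mono fun a ha => ?_
    obtain ⟨b, hb1, hb2⟩ := Metric.mem_thickening_iff.1 ha
    have h4 : |h b - h a| ≤ |b - a| := by
      simpa [Real.dist_eq] using hL.dist_le_mul b a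
    rw [dist_comm, Real.dist_eq] at hb2
    have h5 := le_abs_self (h b - h a)
    simp only [Set.mem_ofPred_eq, hfv] at hb1 ⊢
    linarith
  have h6 : ∫ t in Set.Ioc 0 ‖f‖, ν.real {a | t ≤ f a + ε}
      ≤ ∫ t in Set.Ioc 0 (‖f‖ + ε), ν.real {a | t ≤ f a + ε} :=
    setIntegral_mono_set (hI _ _ hanti fun t => ⟨measureReal_nonneg, measureReal_le_one⟩)
      (ae_of_all _ fun t => measureReal_nonneg)
      (Set.Ioc_subset_Ioc_right (by linarith)).eventuallyLE
  have h7 : ∫ t, f t ∂μ = ∫ t, h t ∂μ + 1 := by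
    simp only [hfv]; rw [integral_add (hint μ inferInstance) (integrable_const _)]; simp
  have h8 : ∫ t, f t + ε ∂ν = ∫ t, h t ∂ν + 1 + ε := by
    simp only [hfv, add_assoc]
    rw [integral_add (hint ν inferInstance) (integrable_const _)]
    simp
  have h9 : ε * ‖f‖ ≤ ε * 2 := by gcongr
  linarith

theorem blDist_nonneg (μ ν : Measure ℝ) : 0 ≤ blDist μ ν :=
  Real.sSup_nonneg (by rintro r ⟨h, -, -, rfl⟩; exact abs_nonneg _)

theorem blDist_le_of_levyProkhorovEDist_lt {μ ν : Measure ℝ} [IsProbabilityMeasure μ]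
    [IsProbabilityMeasure ν] {ε : ℝ} (hε : 0 < ε)
    (hμν : levyProkhorovEDist μ ν < ENNReal.ofReal ε) : blDist μ ν ≤ 3 * ε := by
  refine Real.sSup_le ?_ (by positivity)
  rintro r ⟨h, hL, hb, rfl⟩
  have h1 := integral_le_of_levyProkhorovEDist_lt hε hμν hL hb
  have h2 := integral_le_of_levyProkhorovEDist_lt hε (levyProkhorovEDist_comm μ ν ▸ hμν) hL hb
  rw [abs_le]; constructor <;> linarith

/-- The Lévy–Prokhorov distance metrizes weak convergence on the line and dominates `blDist` up to
the factor 3. -/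
theorem tendsto_blDist {μ : ℕ → ProbabilityMeasure ℝ} {ν : ProbabilityMeasure ℝ}
    (h : Tendsto μ atTop (𝓝 ν)) :
    Tendsto (fun m => blDist (μ m : Measure ℝ) (ν : Measure ℝ)) atTop (𝓝 0) := by
  have h1 := (LevyProkhorov.continuous_ofMeasure_probabilityMeasure.tendsto ν).comp h
  rw [tendsto_iff_edist_tendsto_0] at h1
  rw [Metric.tendsto_atTop']
  intro ε hε
  have h2 := (h1.eventually (gt_mem_nhds (ENNReal.ofReal_pos.2 (by positivity : 0 < ε / 4))))
  obtain ⟨M, hM⟩ := eventually_atTop.1 h2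
  refine ⟨M, fun m hm => ?_⟩
  have h3 : blDist (μ m : Measure ℝ) (ν : Measure ℝ) ≤ 3 * (ε / 4) :=
    blDist_le_of_levyProkhorovEDist_lt (by positivity) (hM m hm.le)
  rw [Real.dist_eq, sub_zero, abs_of_nonneg (blDist_nonneg _ _)]
  linarith

/-! ### Gaussian quadratic forms -/

/-- Because `T = T' T`, the sandwich is the Gram matrix of `T * CFC.sqrt S`. -/
theorem sandwich_posSemidef {ι : Type*} [Fintype ι] [DecidableEq ι] (S T : Matrix ι ι ℝ)
    (hT : T.IsSymm) (hT2 : T * T = T) : (CFC.sqrt S * T * CFC.sqrt S).PosSemidef := by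
  have h1 : (CFC.sqrt S)ᴴ = CFC.sqrt S := (CFC.sqrt_nonneg S).posSemidef.isHermitian
  have h2 : Tᴴ = T := by rw [Matrix.conjTranspose_eq_transpose_of_trivial]; exact hT
  have h3 := Matrix.posSemidef_conjTranspose_mul_self (T * CFC.sqrt S)
  rwa [Matrix.conjTranspose_mul, h1, h2, Matrix.mul_assoc, ← Matrix.mul_assoc T T, hT2,
    ← Matrix.mul_assoc] at h3

theorem weights_nonneg {ι : Type*} [Fintype ι] [DecidableEq ι] (S T : Matrix ι ι ℝ)
    (hT : T.IsSymm) (hT2 : T * T = T) (h : ι) : 0 ≤ weights S T hT h :=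
  (sandwich_posSemidef S T hT hT2).eigenvalues_nonneg h

variable {a d : ℕ}

theorem continuous_quadForm (T : Matrix (Fin a × Fin d) (Fin a × Fin d) ℝ) :
    Continuous (quadForm T) := by
  unfold quadForm
  fun_prop

/-- Parseval in the eigenvector basis, with `A` moved onto the basis vectors by symmetry. -/
theorem dotProduct_mulVec_eq_sum_eigenvalues {ι : Type*} [Fintype ι] [DecidableEq ι]
    {A : Matrix ι ι ℝ} (hA : A.IsHermitian) (y : EuclideanSpace ℝ ι) :
    y.ofLp ⬝ᵥ (A *ᵥ y.ofLp) =
      ∑ h, hA.eigenvalues h * (hA.eigenvectorBasis.repr y).ofLp h ^ 2 := by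
  have h1 : y.ofLp ⬝ᵥ (A *ᵥ y.ofLp) = inner ℝ y (WithLp.toLp 2 (A *ᵥ y.ofLp)) := by
    simp [PiLp.inner_apply, dotProduct, mul_comm]
  rw [h1, ← hA.eigenvectorBasis.sum_inner_mul_inner]
  refine Finset.sum_congr rfl fun h _ => ?_
  rw [OrthonormalBasis.repr_apply_apply]
  have h2 : inner ℝ (hA.eigenvectorBasis h) (WithLp.toLp 2 (A *ᵥ y.ofLp))
      = hA.eigenvalues h * inner ℝ (hA.eigenvectorBasis h) y := by
    have h3 : inner ℝ (hA.eigenvectorBasis h) (WithLp.toLp 2 (A *ᵥ y.ofLp))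
        = (hA.eigenvectorBasis h).ofLp ⬝ᵥ (A *ᵥ y.ofLp) := by
      simp [PiLp.inner_apply, dotProduct, mul_comm]
    have h4 : inner ℝ (hA.eigenvectorBasis h) y = (hA.eigenvectorBasis h).ofLp ⬝ᵥ y.ofLp := by
      simp [PiLp.inner_apply, dotProduct, mul_comm]
    have h5 : Aᵀ = A := by
      have := hA; rwa [Matrix.IsHermitian, Matrix.conjTranspose_eq_transpose_of_trivial] at this
    rw [h3, h4, Matrix.dotProduct_mulVec, ← Matrix.mulVec_transpose, h5, hA.mulVec_eigenvectorBasis,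
      smul_dotProduct, smul_eq_mul]
  rw [h2, real_inner_comm (hA.eigenvectorBasis h) y]; ring

/-- With `Z = S^{1/2} Y` and `Y` standard Gaussian, `Z' T Z` is the sandwich form in `Y`. Its
eigencoordinates are an orthogonal image of `Y`, hence again independent standard normal. -/
theorem gaussianQuadLaw_eq_weightedChiSqLaw (S T : Matrix (Fin a × Fin d) (Fin a × Fin d) ℝ)
    (hT : T.IsSymm) : gaussianQuadLaw S T = weightedChiSqLaw (weights S T hT) := by
  have hS : (CFC.sqrt S)ᵀ = CFC.sqrt S := by
    have : (CFC.sqrt S)ᴴ = CFC.sqrt S := (CFC.sqrt_nonneg S).posSemidef.isHermitian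
    rwa [Matrix.conjTranspose_eq_transpose_of_trivial] at this
  set hA := isHermitian_sandwich S T hT
  have hq := (continuous_quadForm T).measurable
  unfold gaussianQuadLaw weightedChiSqLaw multivariateGaussian
  rw [Measure.map_map (by fun_prop) (by fun_prop)]
  have h1 : ((fun z : EuclideanSpace ℝ (Fin a × Fin d) => quadForm T z.ofLp) ∘ fun x =>
      0 + toEuclideanCLM (𝕜 := ℝ) (CFC.sqrt S) x) =
      (fun z : EuclideanSpace ℝ (Fin a × Fin d) => ∑ h, weights S T hT h * z.ofLp h ^ 2) ∘
        hA.eigenvectorBasis.repr := by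
    funext y
    have h2 := dotProduct_mulVec_eq_sum_eigenvalues hA y
    simp only [Function.comp, zero_add, quadForm, weights]
    rw [← h2, ofLp_toEuclideanCLM]
    rw [← Matrix.mulVec_mulVec, ← Matrix.mulVec_mulVec, Matrix.dotProduct_mulVec y.ofLp,
      ← Matrix.mulVec_transpose, hS]
  rw [h1, ← Measure.map_map (by fun_prop) (by fun_prop), stdGaussian_map, ← map_pi_eq_stdGaussian,
    Measure.map_map (by fun_prop) (by fun_prop)]
  rfl

/-! ### Conditional laws under independence -/

/-- Freezing: by almost sure uniqueness of disintegrations it suffices that the law of `X`, composed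
with the kernel `x ↦ law of f (x, D)`, is the joint law. This follows from Fubini for the product
law of `(X, D)`. -/
theorem condDistrib_of_indepFun {Ω α β γ : Type*} [MeasurableSpace Ω] [MeasurableSpace α]
    [MeasurableSpace β] [MeasurableSpace γ] [StandardBorelSpace γ] [Nonempty γ]
    {P : Measure Ω} [IsProbabilityMeasure P] {X : Ω → α} {D : Ω → β} (hX : Measurable X)
    (hD : Measurable D) (hXD : IndepFun X D P) {f : α × β → γ} (hf : Measurable f) :
    ∀ᵐ ω ∂P, condDistrib (fun ω => f (X ω, D ω)) X P (X ω) = P.map fun ω' => f (X ω, D ω') := by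
  have := Measure.isProbabilityMeasure_map (μ := P) hD.aemeasurable
  let κ : Kernel α γ := (Kernel.id ×ₖ Kernel.const α (P.map D)).map f
  have hκ : ∀ x, κ x = P.map fun ω' => f (x, D ω') := by
    intro x
    rw [Kernel.map_apply _ hf, Kernel.prod_apply, Kernel.id_apply, Kernel.const_apply,
      Measure.dirac_prod, Measure.map_map hf (by fun_prop), Measure.map_map (by fun_prop) hD]
    rfl
  have hκm : IsMarkovKernel κ := Kernel.IsMarkovKernel.map _ hf
  have h := condDistrib_ae_eq_of_measure_eq_compProd (μ := P) X
    (Y := fun ω => f (X ω, D ω)) (κ := κ) (by fun_prop) ?_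
  · filter_upwards [ae_of_ae_map hX.aemeasurable h] with ω hω
    rw [hω, hκ]
  · have h2 := (indepFun_iff_map_prod_eq_prod_map_map hX.aemeasurable hD.aemeasurable).1 hXD
    have h3 : (fun ω => (X ω, f (X ω, D ω))) = (fun p : α × β => (p.1, f p)) ∘
      fun ω => (X ω, D ω) := rfl
    have := Measure.isProbabilityMeasure_map (μ := P) hX.aemeasurable
    rw [h3, ← Measure.map_map (by fun_prop) (by fun_prop), h2]
    ext s hs
    rw [Measure.map_apply (by fun_prop) hs, Measure.compProd_apply hs, Measure.prod_apply
      (hs.preimage (by fun_prop))]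
    refine lintegral_congr fun x => ?_
    rw [hκ, Measure.map_apply (by fun_prop) (hs.preimage (by fun_prop)),
      Measure.map_apply hD (by measurability)]
    rfl

/-! ### A central limit theorem for weighted sums of i.i.d. variables -/

/-- Telescoping: factors are exchanged one at a time, all the others having modulus at most 1. -/
theorem norm_prod_sub_prod_le_sum {κ : Type*} (I : Finset κ) (f g : κ → ℂ)
    (hf : ∀ s ∈ I, ‖f s‖ ≤ 1) (hg : ∀ s ∈ I, ‖g s‖ ≤ 1) :
    ‖∏ s ∈ I, f s - ∏ s ∈ I, g s‖ ≤ ∑ s ∈ I, ‖f s - g s‖ := by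
  classical
  induction I using Finset.induction with
  | empty => simp
  | insert b J hb ih =>
    rw [Finset.prod_insert hb, Finset.prod_insert hb, Finset.sum_insert hb]
    have h1 : ‖∏ s ∈ J, f s‖ ≤ 1 := by
      rw [norm_prod]
      exact Finset.prod_le_one (fun _ _ => norm_nonneg _)
        fun s hs => hf s (Finset.mem_insert_of_mem hs)
    have h2 := ih (fun s hs => hf s (Finset.mem_insert_of_mem hs))
      fun s hs => hg s (Finset.mem_insert_of_mem hs)
    calc ‖f b * ∏ s ∈ J, f s - g b * ∏ s ∈ J, g s‖
        = ‖(f b - g b) * ∏ s ∈ J, f s + g b * (∏ s ∈ J, f s - ∏ s ∈ J, g s)‖ := by ring_nf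
      _ ≤ ‖f b - g b‖ * ‖∏ s ∈ J, f s‖ + ‖g b‖ * ‖∏ s ∈ J, f s - ∏ s ∈ J, g s‖ := by
        rw [← norm_mul, ← norm_mul]; exact norm_add_le _ _
      _ ≤ ‖f b - g b‖ * 1 + 1 * ‖∏ s ∈ J, f s - ∏ s ∈ J, g s‖ := by
        gcongr
        exact hg b (Finset.mem_insert_self _ _)
      _ ≤ _ := by linarith

/-- The Gaussian factor agrees with the Taylor polynomial up to `O(t ^ 4)`. Unlike the polynomial it
has modulus at most 1 everywhere, as the telescoping bound requires. -/
theorem isLittleO_sub_exp_neg_sq {φ : ℝ → ℂ}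
    (h : (fun t : ℝ => φ t - (1 - (t : ℂ) ^ 2 / 2)) =o[𝓝 0] fun t => t ^ 2) :
    (fun t : ℝ => φ t - Complex.exp (-(t : ℂ) ^ 2 / 2)) =o[𝓝 0] fun t => t ^ 2 := by
  have h1 : (fun t : ℝ => Complex.exp (-(t : ℂ) ^ 2 / 2) - (1 - (t : ℂ) ^ 2 / 2))
      =o[𝓝 0] fun t => t ^ 2 := by
    have h2 : (fun t : ℝ => Complex.exp (-(t : ℂ) ^ 2 / 2) - (1 - (t : ℂ) ^ 2 / 2))
        =O[𝓝 0] fun t => t ^ 4 := by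
      refine Asymptotics.IsBigO.of_bound 1 ?_
      have h3 : ∀ᶠ t : ℝ in 𝓝 0, |t| < 1 := by
        filter_upwards [Metric.ball_mem_nhds (0 : ℝ) one_pos] with t ht
        simpa [Real.dist_eq] using ht
      filter_upwards [h3] with t ht
      have ht2 : t ^ 2 ≤ 1 := by rw [sq_le_one_iff_abs_le_one]; exact ht.le
      have hn : ‖(-(t : ℂ) ^ 2 / 2)‖ = t ^ 2 / 2 := by
        rw [norm_div, norm_neg, norm_pow, Complex.norm_real, Real.norm_eq_abs, sq_abs]; simp
      have h4 := Complex.norm_exp_sub_one_sub_id_le (x := -(t : ℂ) ^ 2 / 2)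
        (by rw [hn]; linarith [sq_nonneg t])
      have h5 : Complex.exp (-(t : ℂ) ^ 2 / 2) - (1 - (t : ℂ) ^ 2 / 2)
          = Complex.exp (-(t : ℂ) ^ 2 / 2) - 1 - (-(t : ℂ) ^ 2 / 2) := by ring
      rw [h5, one_mul, Real.norm_eq_abs, abs_of_nonneg (by positivity)]
      rw [hn] at h4
      nlinarith [sq_nonneg (t ^ 2)]
    refine h2.trans_isLittleO ?_
    exact Asymptotics.isLittleO_pow_pow (by norm_num)
  refine (h.sub h1).congr_left fun t => ?_
  ring

/-- All factors share one `φ`, so a single `o(t ^ 2)` estimate serves every factor. Uniform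
smallness of the arguments therefore takes the place of a Lindeberg condition. -/
theorem tendsto_prod_exp_of_isLittleO {κ : Type*} {φ : ℝ → ℂ} (hφ1 : ∀ t, ‖φ t‖ ≤ 1)
    (hφ : (fun t : ℝ => φ t - (1 - (t : ℂ) ^ 2 / 2)) =o[𝓝 0] fun t => t ^ 2)
    {I : ℕ → Finset κ} {u : ℕ → κ → ℝ} {v : ℝ}
    (hv : Tendsto (fun m => ∑ s ∈ I m, u m s ^ 2) atTop (𝓝 v))
    (hu : ∀ ε > 0, ∀ᶠ m in atTop, ∀ s ∈ I m, |u m s| ≤ ε) :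
    Tendsto (fun m => ∏ s ∈ I m, φ (u m s)) atTop (𝓝 (Complex.exp (-v / 2))) := by
  have h1 : Tendsto (fun m => ∏ s ∈ I m, Complex.exp (-(u m s : ℂ) ^ 2 / 2)) atTop
      (𝓝 (Complex.exp (-v / 2))) := by
    have h2 : ∀ m, ∏ s ∈ I m, Complex.exp (-(u m s : ℂ) ^ 2 / 2)
        = Complex.exp (-((∑ s ∈ I m, u m s ^ 2 : ℝ) : ℂ) / 2) := by
      intro m
      rw [← Complex.exp_sum]
      congr 1
      push_cast
      rw [← Finset.sum_neg_distrib, Finset.sum_div]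
    simp_rw [h2]
    have h3 : Continuous fun x : ℝ => Complex.exp (-(x : ℂ) / 2) := by fun_prop
    exact (h3.tendsto v).comp hv
  have h4 : Tendsto (fun m => ∏ s ∈ I m, φ (u m s)
      - ∏ s ∈ I m, Complex.exp (-(u m s : ℂ) ^ 2 / 2)) atTop (𝓝 0) := by
    rw [Metric.tendsto_atTop']
    intro ε hε
    have hv0 : 0 ≤ v := ge_of_tendsto' hv fun m => Finset.sum_nonneg fun s _ => sq_nonneg _
    -- Eventually the squares sum to less than `v + 1`, so this constant makes the total error
    -- smaller than `ε`.
    have hc : 0 < ε / (v + 2) := by positivity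
    have h5 := (isLittleO_sub_exp_neg_sq hφ).bound hc
    obtain ⟨η, hη, h6⟩ := Metric.eventually_nhds_iff.1 h5
    have h7 := (hu (η / 2) (by positivity)).and (hv.eventually (gt_mem_nhds (by linarith : v < v + 1)))
    obtain ⟨M, hM⟩ := eventually_atTop.1 h7
    refine ⟨M, fun m hm => ?_⟩
    obtain ⟨h8, h9⟩ := hM m hm.le
    rw [dist_zero_right]
    calc _ ≤ ∑ s ∈ I m, ‖φ (u m s) - Complex.exp (-(u m s : ℂ) ^ 2 / 2)‖ := by
          refine norm_prod_sub_prod_le_sum _ _ _ (fun s _ => hφ1 _) fun s _ => ?_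
          have : (-(u m s : ℂ) ^ 2 / 2) = ((-(u m s) ^ 2 / 2 : ℝ) : ℂ) := by push_cast; ring
          rw [this, Complex.norm_exp_ofReal, Real.exp_le_one_iff]
          linarith [sq_nonneg (u m s)]
      _ ≤ ∑ s ∈ I m, ε / (v + 2) * u m s ^ 2 := by
          refine Finset.sum_le_sum fun s hs => ?_
          have h10 := h6 (y := u m s) (by
            rw [dist_zero_right, Real.norm_eq_abs]; linarith [h8 s hs])
          rwa [Real.norm_eq_abs, abs_of_nonneg (sq_nonneg (u m s))] at h10
      _ = ε / (v + 2) * ∑ s ∈ I m, u m s ^ 2 := by rw [Finset.mul_sum]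
      _ ≤ ε / (v + 2) * (v + 1) := by gcongr
      _ < ε := by rw [div_mul_eq_mul_div, div_lt_iff₀ (by positivity)]; nlinarith
  simpa using h4.add h1

section weightedSum

variable {Ω : Type*} [MeasurableSpace Ω] {P : Measure Ω} {κ ι : Type*} [Fintype ι]

theorem charFun_weighted_sum {D : κ → Ω → ℝ} (hDm : ∀ s, Measurable (D s)) (hD : iIndepFun D P)
    (s₀ : κ) (hid : ∀ s, IdentDistrib (D s) (D s₀) P P) (I : Finset κ) (w : κ → ι → ℝ)
    (t : EuclideanSpace ℝ ι) :
    charFun (P.map fun ω => WithLp.toLp 2 fun p => ∑ s ∈ I, D s ω * w s p) t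
      = ∏ s ∈ I, charFun (P.map (D s₀)) (∑ p, w s p * t p) := by
  have h1 : charFun (P.map fun ω => WithLp.toLp 2 fun p => ∑ s ∈ I, D s ω * w s p) t
      = charFun (P.map fun ω => ∑ s ∈ I, (∑ p, w s p * t p) * D s ω) 1 := by
    rw [charFun_apply, charFun_apply, integral_map (by fun_prop) (by fun_prop),
      integral_map (by fun_prop) (by fun_prop)]
    refine integral_congr_ae (ae_of_all _ fun ω => ?_)
    have h2 : inner ℝ (WithLp.toLp 2 fun p => ∑ s ∈ I, D s ω * w s p) t
        = ∑ s ∈ I, (∑ p, w s p * t p) * D s ω := by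
      simp only [PiLp.inner_apply, RCLike.inner_apply, conj_trivial, Finset.mul_sum,
        Finset.sum_mul]
      rw [Finset.sum_comm]
      exact Finset.sum_congr rfl fun s _ => Finset.sum_congr rfl fun p _ => by ring
    simp only [h2, RCLike.inner_apply, conj_trivial, one_mul]
  have h3 : iIndepFun (fun s ω => (∑ p, w s p * t p) * D s ω) P :=
    hD.comp (fun s x => (∑ p, w s p * t p) * x) (fun s => by fun_prop)
  rw [h1, (h3.restrict _).charFun_map_fun_finsetSum_eq_prod (fun _ _ => by fun_prop),
    Finset.prod_apply]
  refine Finset.prod_congr rfl fun s _ => ?_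
  rw [charFun_map_mul_comp (hDm s).aemeasurable, mul_one, (hid s).map_eq]

/-- By Lévy continuity only characteristic functions matter. In direction `t` the weighted sum has
scalar weights `∑ p, w s p * t p`, whose squares sum to a quantity tending to `t' S t`. -/
theorem tendsto_weighted_sum_gaussian [IsProbabilityMeasure P] [DecidableEq ι]
    {D : κ → Ω → ℝ} (hDm : ∀ s, Measurable (D s)) (hD : iIndepFun D P) (s₀ : κ) (hid : ∀ s, IdentDistrib (D s) (D s₀) P P)
    (hmean : ∫ ω, D s₀ ω ∂P = 0) (hvar : variance (D s₀) P = 1)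
    {I : ℕ → Finset κ} {w : ℕ → κ → ι → ℝ} {S : Matrix ι ι ℝ} (hS : S.PosSemidef)
    (hcov : ∀ p q, Tendsto (fun m => ∑ s ∈ I m, w m s p * w m s q) atTop (𝓝 (S p q)))
    (hsmall : ∀ ε > 0, ∀ᶠ m in atTop, ∀ s ∈ I m, ∀ p, |w m s p| ≤ ε) :
    Tendsto (β := ProbabilityMeasure (EuclideanSpace ℝ ι))
      (fun m => ⟨P.map fun ω => WithLp.toLp 2 fun p => ∑ s ∈ I m, D s ω * w m s p,
        Measure.isProbabilityMeasure_map (by fun_prop)⟩) atTop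
      (@nhds (ProbabilityMeasure (EuclideanSpace ℝ ι)) _
        ⟨multivariateGaussian 0 S, inferInstance⟩) := by
  refine ProbabilityMeasure.tendsto_of_tendsto_charFun fun t => ?_
  simp only [ProbabilityMeasure.coe_mk]
  simp_rw [charFun_weighted_sum hDm hD s₀ hid]
  have hsq : P[D s₀ ^ 2] = 1 := by
    rw [← hvar, variance_eq_integral (hDm s₀).aemeasurable]
    simp [hmean]
  have := Measure.isProbabilityMeasure_map (μ := P) (hDm s₀).aemeasurable
  rw [charFun_multivariateGaussian hS]
  have h1 := tendsto_prod_exp_of_isLittleO (fun t => norm_charFun_le_one (μ := P.map (D s₀)) t)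
    (taylor_charFun_two (hDm s₀).aemeasurable hmean hsq) (I := I)
    (u := fun m s => ∑ p, w m s p * t p) (v := t.ofLp ⬝ᵥ S *ᵥ t.ofLp) ?_ ?_
  · convert h1 using 3
    simp
    ring
  · have h2 : ∀ m, ∑ s ∈ I m, (∑ p, w m s p * t p) ^ 2
        = ∑ p, ∑ q, t p * (∑ s ∈ I m, w m s p * w m s q) * t q := by
      intro m
      simp_rw [sq, Finset.sum_mul_sum, Finset.mul_sum, Finset.sum_mul]
      rw [Finset.sum_comm]
      refine Finset.sum_congr rfl fun p _ => ?_
      rw [Finset.sum_comm]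
      exact Finset.sum_congr rfl fun q _ => Finset.sum_congr rfl fun s _ => by ring
    have h3 : t.ofLp ⬝ᵥ S *ᵥ t.ofLp = ∑ p, ∑ q, t p * S p q * t q := by
      simp only [dotProduct, mulVec, Finset.mul_sum, mul_assoc]
    simp_rw [h2, h3]
    exact tendsto_finsetSum _ fun p _ => tendsto_finsetSum _ fun q _ =>
      ((hcov p q).const_mul _).mul_const _
  · intro ε hε
    have hc : 0 < ∑ p, |t p| + 1 := by positivity
    filter_upwards [hsmall (ε / (∑ p, |t p| + 1)) (by positivity)] with m hm s hs
    calc |∑ p, w m s p * t p| ≤ ∑ p, |w m s p * t p| := Finset.abs_sum_le_sum_abs _ _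
      _ ≤ ∑ p, ε / (∑ p, |t p| + 1) * |t p| := by
        refine Finset.sum_le_sum fun p _ => ?_
        rw [abs_mul]
        gcongr
        exact hm s hs p
      _ = ε / (∑ p, |t p| + 1) * ∑ p, |t p| := by rw [Finset.mul_sum]
      _ ≤ ε := by rw [div_mul_eq_mul_div, div_le_iff₀ hc]; nlinarith

end weightedSum

/-! ### The bootstrap vector as a weighted sum of the multipliers -/

theorem c_nonneg (u : ℝ) : 0 ≤ c u := by
  unfold c; split_ifs <;> norm_num

theorem c_le_one (u : ℝ) : c u ≤ 1 := by
  unfold c; split_ifs <;> norm_num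

/-- The value 1/2 at zero makes this hold at ties too, so the distributions need not be continuous.
-/
theorem c_sub_comm (s t : ℝ) : c (s - t) = 1 - c (t - s) := by
  unfold c
  rcases lt_trichotomy s t with h | h | h
  · rw [if_neg (by linarith), if_neg (by intro h2; linarith), if_pos (by linarith)]; norm_num
  · subst h; norm_num
  · rw [if_pos (by linarith), if_neg (by linarith), if_neg (by intro h2; linarith)]; norm_num

@[fun_prop]
theorem measurable_c : Measurable c := by
  unfold c
  exact Measurable.ite measurableSet_Ioi measurable_const
    (Measurable.ite (measurableSet_singleton 0) measurable_const measurable_const)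

theorem average_mem_Icc (N : ℕ) (f : ℕ → ℝ) (hf : ∀ k, f k ∈ Set.Icc (0 : ℝ) 1) :
    (1 / (N : ℝ)) * ∑ k ∈ Finset.range N, f k ∈ Set.Icc (0 : ℝ) 1 := by
  have h0 : 0 ≤ ∑ k ∈ Finset.range N, f k := Finset.sum_nonneg fun k _ => (hf k).1
  have h1 : ∑ k ∈ Finset.range N, f k ≤ N := by
    calc _ ≤ ∑ k ∈ Finset.range N, (1 : ℝ) := Finset.sum_le_sum fun k _ => (hf k).2
      _ = N := by simp
  refine ⟨by positivity, ?_⟩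
  rw [one_div_mul_eq_div]
  exact div_le_one_of_le₀ h1 (Nat.cast_nonneg _)

theorem empCDF_mem_Icc (n : Fin a → ℕ) (x : Fin a → ℕ → Fin d → ℝ) (i : Fin a) (j : Fin d)
    (t : ℝ) : empCDF n x i j t ∈ Set.Icc (0 : ℝ) 1 :=
  average_mem_Icc _ _ fun _ => ⟨c_nonneg _, c_le_one _⟩

/-- The centered value of `F̂_{ij}` at the `j`-th component of the `k`-th observation in
group `r`. -/
noncomputable def empDev (n : Fin a → ℕ) (x : Fin a → ℕ → Fin d → ℝ) (r : Fin a) (k : ℕ)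
    (i : Fin a) (j : Fin d) : ℝ :=
  empCDF n x i j (x r k j) - empInt n x r j (empCDF n x i j)

theorem abs_empDev_le_one (n : Fin a → ℕ) (x : Fin a → ℕ → Fin d → ℝ) (r : Fin a) (k : ℕ)
    (i : Fin a) (j : Fin d) : |empDev n x r k i j| ≤ 1 := by
  have h1 := empCDF_mem_Icc n x i j (x r k j)
  have h2 : empInt n x r j (empCDF n x i j) ∈ Set.Icc (0 : ℝ) 1 :=
    average_mem_Icc _ _ fun _ => empCDF_mem_Icc n x i j _
  unfold empDev
  rw [abs_le]
  constructor <;> linarith [h1.1, h1.2, h2.1, h2.2]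

/-- The coefficient of `F_{lj}` in the influence function of group `r` for the effect
`p_{ij}`. -/
noncomputable def effectCoef (r : Fin a) (p : Fin a × Fin d) (l : Fin a) : ℝ :=
  (if r = p.1 then 1 else 0) - (if l = p.1 then 1 else 0)

theorem abs_effectCoef_le_one (r : Fin a) (p : Fin a × Fin d) (l : Fin a) :
    |effectCoef r p l| ≤ 1 := by
  unfold effectCoef; split_ifs <;> norm_num

/-- The coefficient of the multiplier `D_{rk}` in the `p`-th entry of the bootstrap vector. -/
noncomputable def wildWeight (n : Fin a → ℕ) (x : Fin a → ℕ → Fin d → ℝ) (s : Fin a × ℕ)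
    (p : Fin a × Fin d) : ℝ :=
  √(total n : ℝ) / (a * n s.1) * ∑ l, effectCoef s.1 p l * empDev n x s.1 s.2 l p.2

theorem average_c_eq {n : Fin a → ℕ} (x : Fin a → ℕ → Fin d → ℝ) (i : Fin a) (j : Fin d)
    (hn : n i ≠ 0) (t : ℝ) :
    (1 / (n i : ℝ)) * ∑ k ∈ Finset.range (n i), c (x i k j - t) = 1 - empCDF n x i j t := by
  have h : (n i : ℝ) ≠ 0 := Nat.cast_ne_zero.2 hn
  unfold empCDF
  simp_rw [c_sub_comm _ t, Finset.sum_sub_distrib, mul_sub]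
  simp [h]

/-- Integration by parts for normalized empirical distribution functions: swap the double sum and
use `c_sub_comm`. -/
theorem empInt_empCDF_comm {n : Fin a → ℕ} (x : Fin a → ℕ → Fin d → ℝ) (i l : Fin a) (j : Fin d)
    (hi : n i ≠ 0) (hl : n l ≠ 0) :
    empInt n x i j (empCDF n x l j) = 1 - empInt n x l j (empCDF n x i j) := by
  have h : (n l : ℝ) ≠ 0 := Nat.cast_ne_zero.2 hl
  have h1 : empInt n x i j (empCDF n x l j)
      = (1 / (n l : ℝ)) * ∑ k ∈ Finset.range (n l), (1 - empCDF n x i j (x l k j)) := by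
    simp_rw [← average_c_eq x i j hi]
    unfold empInt empCDF
    simp_rw [Finset.mul_sum]
    rw [Finset.sum_comm]
    exact Finset.sum_congr rfl fun _ _ => Finset.sum_congr rfl fun _ _ => by ring
  rw [h1]
  unfold empInt
  rw [Finset.sum_sub_distrib, mul_sub]
  simp [h]

/-- Averaging the residual of individual `k` over group `i` moves the evaluation to that
individual's own observation. The antisymmetry of `c` produces the minus sign, and the subtracted
`F̂_{lj}` produces the centering. -/
theorem empInt_wildCDF {n : Fin a → ℕ} (x : Fin a → ℕ → Fin d → ℝ) (D : Fin a → ℕ → ℝ)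
    (i l : Fin a) (j : Fin d) (hi : n i ≠ 0) (hl : n l ≠ 0) :
    empInt n x i j (wildCDF n x D l j)
      = -((1 / (n l : ℝ)) * ∑ k ∈ Finset.range (n l), D l k * empDev n x l k i j) := by
  have h1 : ∀ k, empDev n x l k i j = -((1 / (n i : ℝ)) * ∑ k' ∈ Finset.range (n i),
      (c (x i k' j - x l k j) - empCDF n x l j (x i k' j))) := by
    intro k
    have h2 := empInt_empCDF_comm x i l j hi hl
    rw [Finset.sum_sub_distrib, mul_sub, average_c_eq x i j hi]
    unfold empDev
    unfold empInt at h2 ⊢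
    linarith
  simp_rw [h1]
  unfold empInt wildCDF wildResid
  simp_rw [mul_neg, Finset.sum_neg_distrib, mul_neg, neg_neg, Finset.mul_sum]
  rw [Finset.sum_comm]
  exact Finset.sum_congr rfl fun _ _ => Finset.sum_congr rfl fun _ _ => by ring

theorem wildEffect_eq {n : Fin a → ℕ} (x : Fin a → ℕ → Fin d → ℝ) (D : Fin a → ℕ → ℝ)
    (i : Fin a) (j : Fin d) (hn : ∀ i, n i ≠ 0) :
    wildEffect n x D i j = (1 / (a : ℝ)) * ∑ l,
      ((1 / (n i : ℝ)) * ∑ k ∈ Finset.range (n i), D i k * empDev n x i k l j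
        - (1 / (n l : ℝ)) * ∑ k ∈ Finset.range (n l), D l k * empDev n x l k i j) := by
  have h1 : empInt n x i j (wildMeanCDF n x D j)
      = (1 / (a : ℝ)) * ∑ l, empInt n x i j (wildCDF n x D l j) := by
    unfold empInt wildMeanCDF
    simp_rw [Finset.mul_sum]
    rw [Finset.sum_comm]
    exact Finset.sum_congr rfl fun _ _ => Finset.sum_congr rfl fun _ _ => by ring
  unfold wildEffect empMeanInt
  rw [h1, ← mul_sub, ← Finset.sum_sub_distrib]
  congr 1
  refine Finset.sum_congr rfl fun l _ => ?_
  rw [empInt_wildCDF x D i l j (hn i) (hn l), empInt_wildCDF x D l i j (hn l) (hn i)]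
  ring

/-- Collecting the coefficient of each multiplier: group `p.1` receives a term for every `l`, each
group `r` loses its term in `F̂` of group `p.1`, and the two cancel when `l = r = p.1`. -/
theorem pStar_eq {n : Fin a → ℕ} (x : Fin a → ℕ → Fin d → ℝ) (D : Fin a → ℕ → ℝ)
    (hn : ∀ i, n i ≠ 0) (p : Fin a × Fin d) :
    pStar n x D p = ∑ r, ∑ k ∈ Finset.range (n r), D r k * wildWeight n x (r, k) p := by
  have h1 : ∀ r, ∑ k ∈ Finset.range (n r), D r k * wildWeight n x (r, k) p
      = √(total n : ℝ) * (1 / (a : ℝ)) * ((if r = p.1 then ∑ l, (1 / (n r : ℝ)) *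
          ∑ k ∈ Finset.range (n r), D r k * empDev n x r k l p.2 else 0)
        - (1 / (n r : ℝ)) * ∑ k ∈ Finset.range (n r), D r k * empDev n x r k p.1 p.2) := by
    intro r
    have h2 : ∀ k, D r k * wildWeight n x (r, k) p = √(total n : ℝ) * (1 / (a : ℝ)) *
        ((1 / (n r : ℝ)) * ((if r = p.1 then ∑ l, D r k * empDev n x r k l p.2 else 0)
          - D r k * empDev n x r k p.1 p.2)) := by
      intro k
      unfold wildWeight effectCoef
      simp only [sub_mul, Finset.sum_sub_distrib, ite_mul, one_mul, zero_mul, Finset.sum_ite_eq',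
        Finset.mem_univ, if_true, ← Finset.mul_sum]
      split_ifs
      · ring
      · simp; ring
    simp_rw [h2]
    rw [← Finset.mul_sum, ← Finset.mul_sum, Finset.sum_sub_distrib, mul_sub]
    congr 2
    split_ifs
    · rw [Finset.sum_comm, Finset.mul_sum]
    · simp
  simp_rw [h1]
  unfold pStar
  rw [wildEffect_eq x D p.1 p.2 hn, ← Finset.mul_sum, Finset.sum_sub_distrib,
    Finset.sum_sub_distrib, Finset.sum_ite_eq', if_pos (Finset.mem_univ _)]
  ring

/-! ### Covariances -/

/-- The empirical covariance, in group `r`, of `F̂_{ij}` and `F̂_{i'j'}`. -/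
noncomputable def empCov (n : Fin a → ℕ) (x : Fin a → ℕ → Fin d → ℝ) (r i : Fin a) (j : Fin d)
    (i' : Fin a) (j' : Fin d) : ℝ :=
  (1 / (n r : ℝ)) * ∑ k ∈ Finset.range (n r), empDev n x r k i j * empDev n x r k i' j'

/-- For multipliers of unit variance this is the conditional covariance matrix of the bootstrap
vector, in the same shape as `asymCov_eq`. -/
theorem sum_wildWeight_mul {n : Fin a → ℕ} (x : Fin a → ℕ → Fin d → ℝ) (hn : ∀ i, n i ≠ 0)
    (p q : Fin a × Fin d) :
    ∑ r, ∑ k ∈ Finset.range (n r), wildWeight n x (r, k) p * wildWeight n x (r, k) q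
      = ∑ r, (total n / n r : ℝ) / (a : ℝ) ^ 2 *
        ∑ l, ∑ l', effectCoef r p l * effectCoef r q l' * empCov n x r l p.2 l' q.2 := by
  refine Finset.sum_congr rfl fun r _ => ?_
  have h : (n r : ℝ) ≠ 0 := Nat.cast_ne_zero.2 (hn r)
  have h1 : ∀ k, wildWeight n x (r, k) p * wildWeight n x (r, k) q
      = (total n / n r : ℝ) / (a : ℝ) ^ 2 * ∑ l, ∑ l', effectCoef r p l * effectCoef r q l' *
        ((1 / (n r : ℝ)) * (empDev n x r k l p.2 * empDev n x r k l' q.2)) := by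
    intro k
    unfold wildWeight
    rw [mul_mul_mul_comm, Finset.sum_mul_sum, div_mul_div_comm,
      Real.mul_self_sqrt (Nat.cast_nonneg _), Finset.mul_sum, Finset.mul_sum]
    refine Finset.sum_congr rfl fun l _ => ?_
    rw [Finset.mul_sum, Finset.mul_sum]
    refine Finset.sum_congr rfl fun l' _ => ?_
    simp only
    rcases eq_or_ne (a : ℝ) 0 with ha | ha
    · simp [ha]
    · field_simp
  simp_rw [h1]
  rw [← Finset.mul_sum, Finset.sum_comm]
  congr 1
  refine Finset.sum_congr rfl fun l _ => ?_
  rw [Finset.sum_comm]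
  refine Finset.sum_congr rfl fun l' _ => ?_
  unfold empCov
  rw [Finset.mul_sum, Finset.mul_sum]

theorem empCov_eq {n : Fin a → ℕ} (x : Fin a → ℕ → Fin d → ℝ) (r i : Fin a) (j : Fin d)
    (i' : Fin a) (j' : Fin d) (hn : n r ≠ 0) :
    empCov n x r i j i' j' = (1 / (n r : ℝ)) * ∑ k ∈ Finset.range (n r),
        empCDF n x i j (x r k j) * empCDF n x i' j' (x r k j')
      - empInt n x r j (empCDF n x i j) * empInt n x r j' (empCDF n x i' j') := by
  have h : (n r : ℝ) ≠ 0 := Nat.cast_ne_zero.2 hn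
  have h1 : ∀ i j, ∑ k ∈ Finset.range (n r), empCDF n x i j (x r k j)
      = n r * empInt n x r j (empCDF n x i j) := by
    intro i j; unfold empInt; field_simp
  unfold empCov empDev
  simp_rw [sub_mul, mul_sub, Finset.sum_sub_distrib, ← Finset.sum_mul, ← Finset.mul_sum, h1]
  simp
  field_simp

/-- The four Kronecker terms of `sigmaW` are the expansion of a product of two `effectCoef`. This
form displays `Σ` as a sum over independent groups, for both the limit and positivity. -/
theorem asymCov_eq (Q : Fin a → Measure (Fin d → ℝ)) (lam : Fin a → ℝ) (p q : Fin a × Fin d) :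
    asymCov Q lam p q = ∑ r, (1 / lam r) / (a : ℝ) ^ 2 *
      ∑ l, ∑ l', effectCoef r p l * effectCoef r q l' * covF Q r l p.2 l' q.2 := by
  have h1 : ∀ r, ∑ l, ∑ l', effectCoef r p l * effectCoef r q l' * covF Q r l p.2 l' q.2
      = (if r = p.1 then if r = q.1 then ∑ l, ∑ l', covF Q r l p.2 l' q.2 else 0 else 0)
        - (if r = p.1 then ∑ l, covF Q r l p.2 q.1 q.2 else 0)
        - (if r = q.1 then ∑ l', covF Q r p.1 p.2 l' q.2 else 0)
        + covF Q r p.1 p.2 q.1 q.2 := by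
    intro r
    have h2 : ∀ l l', effectCoef r p l * effectCoef r q l' * covF Q r l p.2 l' q.2
        = (if r = p.1 then if r = q.1 then covF Q r l p.2 l' q.2 else 0 else 0)
          - (if l' = q.1 then if r = p.1 then covF Q r l p.2 l' q.2 else 0 else 0)
          - (if l = p.1 then if r = q.1 then covF Q r l p.2 l' q.2 else 0 else 0)
          + (if l = p.1 then if l' = q.1 then covF Q r l p.2 l' q.2 else 0 else 0) := by
      intro l l'; unfold effectCoef; split_ifs <;> ring
    simp_rw [h2, Finset.sum_add_distrib, Finset.sum_sub_distrib]
    congr 1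
    · congr 1
      · congr 1
        · split_ifs <;> simp
        · simp
      · rw [Finset.sum_comm]; simp
    · rw [Finset.sum_comm]; simp
  simp_rw [h1]
  unfold asymCov sigmaW
  simp only [mul_add, mul_sub, Finset.sum_add_distrib, Finset.sum_sub_distrib]
  simp only [mul_ite, mul_zero, Finset.sum_ite_eq', Finset.sum_ite_eq, Finset.mem_univ, if_true]
  have h3 : ∑ l, ∑ l', (if l = q.1 then 1 / lam l * covF Q l p.1 p.2 l' q.2 else 0)
      = 1 / lam q.1 * ∑ l', covF Q q.1 p.1 p.2 l' q.2 := by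
    rw [Finset.sum_comm]; simp [Finset.mul_sum]
  have h4 : ∑ l, ∑ l', (if p.1 = q.1 then 1 / lam p.1 * covF Q p.1 l p.2 l' q.2 else 0)
      = if p.1 = q.1 then 1 / lam p.1 * ∑ l, ∑ l', covF Q p.1 l p.2 l' q.2 else 0 := by
    split_ifs <;> simp [Finset.mul_sum]
  have h5 : ∑ r, 1 / lam r / (a : ℝ) ^ 2 * covF Q r p.1 p.2 q.1 q.2
      = 1 / (a : ℝ) ^ 2 * ∑ l, 1 / lam l * covF Q l p.1 p.2 q.1 q.2 := by
    rw [Finset.mul_sum]; exact Finset.sum_congr rfl fun _ _ => by ring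
  rw [h3, h4, h5, ← Finset.mul_sum]
  split_ifs <;> ring

theorem normalizedCDF_mem_Icc (μ : Measure ℝ) [IsProbabilityMeasure μ] (t : ℝ) :
    normalizedCDF μ t ∈ Set.Icc (0 : ℝ) 1 := by
  unfold normalizedCDF
  have h1 := measureReal_nonneg (μ := μ) (s := Set.Iio t)
  have h2 := measureReal_nonneg (μ := μ) (s := Set.Iic t)
  have h3 := measureReal_le_one (μ := μ) (s := Set.Iio t)
  have h4 := measureReal_le_one (μ := μ) (s := Set.Iic t)
  constructor <;> linarith

theorem measurable_normalizedCDF (μ : Measure ℝ) [IsProbabilityMeasure μ] :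
    Measurable (normalizedCDF μ) := by
  have h1 : Monotone fun t => μ.real (Set.Iio t) := fun s t h =>
    measureReal_mono (Set.Iio_subset_Iio h)
  have h2 : Monotone fun t => μ.real (Set.Iic t) := fun s t h =>
    measureReal_mono (Set.Iic_subset_Iic.2 h)
  exact (h1.measurable.add h2.measurable).div_const 2

section margCDF

variable (Q : Fin a → Measure (Fin d → ℝ)) [∀ i, IsProbabilityMeasure (Q i)]

theorem margCDF_mem_Icc (i : Fin a) (j : Fin d) (t : ℝ) : margCDF Q i j t ∈ Set.Icc (0 : ℝ) 1 := by
  have := Measure.isProbabilityMeasure_map (μ := Q i)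
    (measurable_pi_apply (X := fun _ : Fin d => ℝ) j).aemeasurable
  exact normalizedCDF_mem_Icc _ t

@[fun_prop]
theorem measurable_margCDF (i : Fin a) (j : Fin d) : Measurable (margCDF Q i j) := by
  have := Measure.isProbabilityMeasure_map (μ := Q i)
    (measurable_pi_apply (X := fun _ : Fin d => ℝ) j).aemeasurable
  exact measurable_normalizedCDF _

theorem memLp_margCDF (r i : Fin a) (j : Fin d) :
    MemLp (fun y => margCDF Q i j (y j)) 2 (Q r) := by
  refine MemLp.of_bound (Measurable.aestronglyMeasurable (by fun_prop)) 1 (ae_of_all _ fun y => ?_)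
  have h := margCDF_mem_Icc Q i j (y j)
  rw [Real.norm_eq_abs, abs_of_nonneg h.1]
  exact h.2

/-- The quadratic form at `z` is a sum over groups of nonnegative multiples of the variance of one
linear combination of the functions `F_{lj}`. -/
theorem posSemidef_asymCov {lam : Fin a → ℝ} (hlam : ∀ i, 0 < lam i) :
    (asymCov Q lam).PosSemidef := by
  refine Matrix.PosSemidef.of_dotProduct_mulVec_nonneg ?_ fun z => ?_
  · ext p q
    rw [Matrix.conjTranspose_apply, star_trivial, asymCov_eq, asymCov_eq]
    refine Finset.sum_congr rfl fun r _ => ?_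
    rw [Finset.sum_comm]
    congr 1
    refine Finset.sum_congr rfl fun l _ => Finset.sum_congr rfl fun l' _ => ?_
    unfold covF
    rw [covariance_comm]
    ring
  · have h1 : star z ⬝ᵥ asymCov Q lam *ᵥ z = ∑ r, (1 / lam r) / (a : ℝ) ^ 2 *
        Var[fun y => ∑ s : (Fin a × Fin d) × Fin a,
          z s.1 * effectCoef r s.1 s.2 * margCDF Q s.2 s.1.2 (y s.1.2); Q r] := by
      have h2 : ∀ r, Var[fun y => ∑ s : (Fin a × Fin d) × Fin a,
          z s.1 * effectCoef r s.1 s.2 * margCDF Q s.2 s.1.2 (y s.1.2); Q r]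
          = ∑ p, ∑ q, z p * z q * ∑ l, ∑ l',
            effectCoef r p l * effectCoef r q l' * covF Q r l p.2 l' q.2 := by
        intro r
        have hm : ∀ s : (Fin a × Fin d) × Fin a,
            MemLp (fun y => z s.1 * effectCoef r s.1 s.2 * margCDF Q s.2 s.1.2 (y s.1.2)) 2
              (Q r) := fun s => (memLp_margCDF Q r s.2 s.1.2).const_mul _
        rw [← covariance_self (Measurable.aemeasurable (by fun_prop)),
          covariance_fun_sum_fun_sum hm hm]
        simp_rw [covariance_const_mul_left, covariance_const_mul_right]
        rw [Fintype.sum_prod_type]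
        refine Finset.sum_congr rfl fun p _ => ?_
        simp_rw [Fintype.sum_prod_type (γ := ℝ) (α₁ := Fin a × Fin d)]
        rw [Finset.sum_comm]
        refine Finset.sum_congr rfl fun q _ => ?_
        simp_rw [Finset.mul_sum]
        refine Finset.sum_congr rfl fun l _ => Finset.sum_congr rfl fun l' _ => ?_
        unfold covF
        ring
      simp_rw [h2, dotProduct, mulVec, dotProduct, asymCov_eq, Finset.mul_sum, Finset.sum_mul,
        Finset.mul_sum]
      symm
      rw [Finset.sum_comm]
      refine Finset.sum_congr rfl fun p _ => ?_
      rw [Finset.sum_comm]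
      refine Finset.sum_congr rfl fun q _ => Finset.sum_congr rfl fun r _ =>
        Finset.sum_congr rfl fun l _ => Finset.sum_congr rfl fun l' _ => ?_
      rw [Pi.star_apply, star_trivial]
      ring
    rw [h1]
    exact Finset.sum_nonneg fun r _ => mul_nonneg
      (div_nonneg (one_div_nonneg.2 (hlam r).le) (sq_nonneg _)) (variance_nonneg _ _)

end margCDF

/-! ### Group sizes -/

section sizes

variable {n : ℕ → Fin a → ℕ} {lam : Fin a → ℝ}

theorem eventually_size_ne_zero (hlam : ∀ i, 0 < lam i)
    (hn : ∀ i, Tendsto (fun m => (n m i : ℝ) / (total (n m) : ℝ)) atTop (𝓝 (lam i))) :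
    ∀ᶠ m in atTop, ∀ i, n m i ≠ 0 := by
  refine eventually_all.2 fun i => ?_
  filter_upwards [(hn i).eventually (lt_mem_nhds (hlam i))] with m hm h
  simp [h] at hm

theorem tendsto_total_div_size (hlam : ∀ i, 0 < lam i)
    (hn : ∀ i, Tendsto (fun m => (n m i : ℝ) / (total (n m) : ℝ)) atTop (𝓝 (lam i))) (i : Fin a) :
    Tendsto (fun m => (total (n m) : ℝ) / (n m i : ℝ)) atTop (𝓝 (1 / lam i)) := by
  rw [one_div]
  exact ((hn i).inv₀ (hlam i).ne').congr fun m => inv_div _ _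

theorem tendsto_sqrt_total_div_size (hN : Tendsto (fun m => total (n m)) atTop atTop)
    (hlam : ∀ i, 0 < lam i)
    (hn : ∀ i, Tendsto (fun m => (n m i : ℝ) / (total (n m) : ℝ)) atTop (𝓝 (lam i))) (i : Fin a) :
    Tendsto (fun m => √(total (n m) : ℝ) / (n m i : ℝ)) atTop (𝓝 0) := by
  have h1 : Tendsto (fun m => (√(total (n m) : ℝ))⁻¹) atTop (𝓝 0) :=
    tendsto_inv_atTop_zero.comp
      (Real.tendsto_sqrt_atTop.comp (tendsto_natCast_atTop_atTop.comp hN))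
  have h2 := h1.mul (tendsto_total_div_size hlam hn i)
  rw [zero_mul] at h2
  refine h2.congr fun m => ?_
  rw [mul_div_assoc', inv_mul_eq_div, Real.div_sqrt]

theorem tendsto_size_atTop (hN : Tendsto (fun m => total (n m)) atTop atTop)
    (hlam : ∀ i, 0 < lam i)
    (hn : ∀ i, Tendsto (fun m => (n m i : ℝ) / (total (n m) : ℝ)) atTop (𝓝 (lam i))) (i : Fin a) :
    Tendsto (fun m => (n m i : ℝ)) atTop atTop := by
  have h1 := (hn i).pos_mul_atTop (hlam i) (tendsto_natCast_atTop_atTop.comp hN)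
  refine h1.congr' ?_
  filter_upwards [hN.eventually_ge_atTop 1] with m hm
  have : (total (n m) : ℝ) ≠ 0 := by positivity
  simp only [Function.comp]
  field_simp

theorem nonempty_of_tendsto_total (hN : Tendsto (fun m => total (n m)) atTop atTop) :
    Nonempty (Fin a) := by
  by_contra h
  rw [not_nonempty_iff] at h
  obtain ⟨m, hm⟩ := (hN.eventually_ge_atTop 1).exists
  simp [total] at hm

end sizes

/-! ### Convergence of the bootstrap law along a sequence of samples -/

/-- The empirical mixed moment, in group `r`, of `F̂_{ij}` and `F̂_{i'j'}`. -/
noncomputable def empMixed (n : Fin a → ℕ) (x : Fin a → ℕ → Fin d → ℝ) (r i : Fin a) (j : Fin d)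
    (i' : Fin a) (j' : Fin d) : ℝ :=
  (1 / (n r : ℝ)) * ∑ k ∈ Finset.range (n r),
    empCDF n x i j (x r k j) * empCDF n x i' j' (x r k j')

theorem covF_eq (Q : Fin a → Measure (Fin d → ℝ)) [∀ i, IsProbabilityMeasure (Q i)]
    (r i : Fin a) (j : Fin d) (i' : Fin a) (j' : Fin d) :
    covF Q r i j i' j' = ∫ y, margCDF Q i j (y j) * margCDF Q i' j' (y j') ∂Q r
      - (∫ y, margCDF Q i j (y j) ∂Q r) * ∫ y, margCDF Q i' j' (y j') ∂Q r :=
  covariance_eq_sub (memLp_margCDF Q r i j) (memLp_margCDF Q r i' j')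

/-- The indices `(r, k)`, `k < n r`, of the observations. -/
def obsIndex (n : Fin a → ℕ) : Finset (Fin a × ℕ) :=
  (Finset.univ.sigma fun r => Finset.range (n r)).map (Equiv.sigmaEquivProd (Fin a) ℕ).toEmbedding

theorem sum_obsIndex (n : Fin a → ℕ) (f : Fin a × ℕ → ℝ) :
    ∑ s ∈ obsIndex n, f s = ∑ r, ∑ k ∈ Finset.range (n r), f (r, k) := by
  unfold obsIndex
  rw [Finset.sum_map, Finset.sum_sigma]
  rfl

theorem abs_wildWeight_le (n : Fin a → ℕ) (x : Fin a → ℕ → Fin d → ℝ) (s : Fin a × ℕ)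
    (p : Fin a × Fin d) : |wildWeight n x s p| ≤ √(total n : ℝ) / n s.1 := by
  have ha : (a : ℝ) ≠ 0 := Nat.cast_ne_zero.2 (Nat.pos_of_ne_zero (by
    rintro rfl; exact s.1.elim0)).ne'
  unfold wildWeight
  rw [abs_mul, abs_of_nonneg (by positivity)]
  calc _ ≤ √(total n : ℝ) / (a * n s.1) * ∑ l : Fin a, (1 : ℝ) := by
        gcongr
        refine (Finset.abs_sum_le_sum_abs _ _).trans (Finset.sum_le_sum fun l _ => ?_)
        rw [abs_mul]
        exact mul_le_one₀ (abs_effectCoef_le_one _ _ _) (abs_nonneg _) (abs_empDev_le_one _ _ _ _ _ _)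
    _ = _ := by
        simp only [Finset.sum_const, Finset.card_univ, Fintype.card_fin, nsmul_eq_mul, mul_one]
        field_simp

section bootstrap

variable {Ω : Type*} [MeasurableSpace Ω] {P : Measure Ω} [IsProbabilityMeasure P]
  (Q : Fin a → Measure (Fin d → ℝ)) [∀ i, IsProbabilityMeasure (Q i)]
  {lam : Fin a → ℝ} {D : Fin a → ℕ → Ω → ℝ}

instance (S T : Matrix (Fin a × Fin d) (Fin a × Fin d) ℝ) :
    IsProbabilityMeasure (gaussianQuadLaw S T) :=
  Measure.isProbabilityMeasure_map ((continuous_quadForm T).measurable.comp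
    (by fun_prop : Measurable fun z : EuclideanSpace ℝ (Fin a × Fin d) => z.ofLp)).aemeasurable

/-- The samples form a deterministic array here; only the multipliers are random. The limits of the
weights' Gram matrix are controlled by two families of empirical moments, and their smallness holds
for every sample. -/
theorem tendsto_blDist_wildATS (hDm : ∀ i k, Measurable (D i k))
    (hDind : iIndepFun (fun s : Fin a × ℕ => D s.1 s.2) P)
    (hDid : ∀ i k i' k', IdentDistrib (D i k) (D i' k') P P)
    (hDmean : ∀ i k, ∫ ω, D i k ω ∂P = 0) (hDvar : ∀ i k, variance (D i k) P = 1)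
    {n : ℕ → Fin a → ℕ} (hN : Tendsto (fun m => total (n m)) atTop atTop)
    (hlam : ∀ i, 0 < lam i)
    (hn : ∀ i, Tendsto (fun m => (n m i : ℝ) / (total (n m) : ℝ)) atTop (𝓝 (lam i)))
    (T : Matrix (Fin a × Fin d) (Fin a × Fin d) ℝ) {x : ℕ → Fin a → ℕ → Fin d → ℝ}
    (hmean : ∀ r i j, Tendsto (fun m => empInt (n m) (x m) r j (empCDF (n m) (x m) i j)) atTop
      (𝓝 (∫ y, margCDF Q i j (y j) ∂Q r)))
    (hmixed : ∀ r i j i' j', Tendsto (fun m => empMixed (n m) (x m) r i j i' j') atTop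
      (𝓝 (∫ y, margCDF Q i j (y j) * margCDF Q i' j' (y j') ∂Q r))) :
    Tendsto (fun m => blDist (P.map fun ω => wildATS T (n m) (x m) fun i k => D i k ω)
      (gaussianQuadLaw (asymCov Q lam) T)) atTop (𝓝 0) := by
  obtain ⟨r₀⟩ := nonempty_of_tendsto_total hN
  have hn0 := eventually_size_ne_zero hlam hn
  have hcov : ∀ r i j i' j', Tendsto (fun m => empCov (n m) (x m) r i j i' j') atTop
      (𝓝 (covF Q r i j i' j')) := by
    intro r i j i' j'
    rw [covF_eq]
    refine ((hmixed r i j i' j').sub ((hmean r i j).mul (hmean r i' j'))).congr' ?_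
    filter_upwards [hn0] with m hm
    exact (empCov_eq (x m) r i j i' j' (hm r)).symm
  have h1 := tendsto_weighted_sum_gaussian (P := P) (D := fun s : Fin a × ℕ => D s.1 s.2)
    (fun s => hDm _ _) hDind (r₀, 0) (fun s => hDid _ _ _ _) (hDmean _ _) (hDvar _ _)
    (I := fun m => obsIndex (n m)) (w := fun m => wildWeight (n m) (x m))
    (posSemidef_asymCov Q hlam) ?_ ?_
  · have hcont : Continuous fun z : EuclideanSpace ℝ (Fin a × Fin d) => quadForm T z.ofLp :=
      (continuous_quadForm T).comp (PiLp.continuous_ofLp 2 _)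
    have h2 := tendsto_blDist (ProbabilityMeasure.tendsto_map_of_tendsto_of_continuous _ _ h1 hcont)
    refine h2.congr' ?_
    filter_upwards [hn0] with m hm
    congr 1
    change (P.map fun ω => WithLp.toLp 2 fun p => ∑ s ∈ obsIndex (n m),
      D s.1 s.2 ω * wildWeight (n m) (x m) s p).map (fun z => quadForm T z.ofLp) = _
    rw [Measure.map_map hcont.measurable (by fun_prop)]
    congr 1
    funext ω
    simp only [Function.comp, wildATS]
    congr 1
    funext p
    rw [pStar_eq _ _ hm, sum_obsIndex]
  · intro p q
    rw [asymCov_eq]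
    have h2 : Tendsto (fun m => ∑ r, (total (n m) / n m r : ℝ) / (a : ℝ) ^ 2 *
        ∑ l, ∑ l', effectCoef r p l * effectCoef r q l' * empCov (n m) (x m) r l p.2 l' q.2) atTop
        (𝓝 (∑ r, (1 / lam r) / (a : ℝ) ^ 2 *
          ∑ l, ∑ l', effectCoef r p l * effectCoef r q l' * covF Q r l p.2 l' q.2)) :=
      tendsto_finsetSum _ fun r _ => ((tendsto_total_div_size hlam hn r).div_const _).mul
        (tendsto_finsetSum _ fun l _ => tendsto_finsetSum _ fun l' _ =>
          (hcov r l p.2 l' q.2).const_mul _)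
    refine h2.congr' ?_
    filter_upwards [hn0] with m hm
    rw [sum_obsIndex, sum_wildWeight_mul _ hm]
  · intro ε hε
    have h2 : ∀ᶠ m in atTop, ∀ r, √(total (n m) : ℝ) / (n m r : ℝ) < ε :=
      eventually_all.2 fun r =>
        (tendsto_sqrt_total_div_size hN hlam hn r).eventually (gt_mem_nhds hε)
    filter_upwards [h2] with m hm s _ p
    exact (abs_wildWeight_le _ _ _ _).trans (hm s.1).le

/-- Uniformity in the sample replaces a passage to almost surely convergent subsequences. Otherwise,
bad samples for `δ = 1 / (N + 1)` at indices `m N ≥ N` would have convergent moments, contradicting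
the sequential statement. -/
theorem exists_blDist_wildATS_lt (hDm : ∀ i k, Measurable (D i k))
    (hDind : iIndepFun (fun s : Fin a × ℕ => D s.1 s.2) P)
    (hDid : ∀ i k i' k', IdentDistrib (D i k) (D i' k') P P)
    (hDmean : ∀ i k, ∫ ω, D i k ω ∂P = 0) (hDvar : ∀ i k, variance (D i k) P = 1)
    {n : ℕ → Fin a → ℕ} (hN : Tendsto (fun m => total (n m)) atTop atTop)
    (hlam : ∀ i, 0 < lam i)
    (hn : ∀ i, Tendsto (fun m => (n m i : ℝ) / (total (n m) : ℝ)) atTop (𝓝 (lam i)))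
    (T : Matrix (Fin a × Fin d) (Fin a × Fin d) ℝ) {ε : ℝ} (hε : 0 < ε) :
    ∃ δ > 0, ∀ᶠ m in atTop, ∀ x : Fin a → ℕ → Fin d → ℝ,
      (∀ r i j, |empInt (n m) x r j (empCDF (n m) x i j) - ∫ y, margCDF Q i j (y j) ∂Q r| < δ) →
      (∀ r i j i' j', |empMixed (n m) x r i j i' j'
        - ∫ y, margCDF Q i j (y j) * margCDF Q i' j' (y j') ∂Q r| < δ) →
      blDist (P.map fun ω => wildATS T (n m) x fun i k => D i k ω)
        (gaussianQuadLaw (asymCov Q lam) T) < ε := by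
  by_contra! h
  have h1 : ∀ N : ℕ, ∃ m x, N ≤ m ∧
      (∀ r i j, |empInt (n m) x r j (empCDF (n m) x i j) - ∫ y, margCDF Q i j (y j) ∂Q r|
        < 1 / ((N : ℝ) + 1)) ∧
      (∀ r i j i' j', |empMixed (n m) x r i j i' j'
        - ∫ y, margCDF Q i j (y j) * margCDF Q i' j' (y j') ∂Q r| < 1 / ((N : ℝ) + 1)) ∧
      ε ≤ blDist (P.map fun ω => wildATS T (n m) x fun i k => D i k ω)
        (gaussianQuadLaw (asymCov Q lam) T) := by
    intro N
    obtain ⟨m, hm, x, h2, h3, h4⟩ := frequently_atTop.1 (h (1 / ((N : ℝ) + 1)) (by positivity)) N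
    exact ⟨m, x, hm, h2, h3, h4⟩
  choose m x hm h2 h3 h4 using h1
  have hmt : Tendsto m atTop atTop := tendsto_atTop_mono hm tendsto_id
  have hlim : ∀ {f : ℕ → ℝ} {l : ℝ}, (∀ N, |f N - l| < 1 / ((N : ℝ) + 1)) →
      Tendsto f atTop (𝓝 l) := fun hf => tendsto_iff_norm_sub_tendsto_zero.2
    (squeeze_zero (fun _ => norm_nonneg _) (fun N => (hf N).le)
      tendsto_one_div_add_atTop_nhds_zero_nat)
  have h5 := tendsto_blDist_wildATS Q hDm hDind hDid hDmean hDvar (n := fun N => n (m N))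
    (hN.comp hmt) hlam (fun i => (hn i).comp hmt) T (x := x)
    (fun r i j => hlim fun N => h2 N r i j) (fun r i j i' j' => hlim fun N => h3 N r i j i' j')
  exact absurd (ge_of_tendsto' h5 h4) (not_le.2 hε)

end bootstrap

/-! ### Second moment bounds for empirical quantities -/

theorem normalizedCDF_eq_integral (μ : Measure ℝ) [IsProbabilityMeasure μ] (t : ℝ) :
    normalizedCDF μ t = ∫ u, c (t - u) ∂μ := by
  have h1 : ∀ u, c (t - u) = ((Set.Iio t).indicator 1 u + (Set.Iic t).indicator 1 u) / 2 := by
    intro u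
    unfold c
    simp only [Set.indicator_apply, Set.mem_Iio, Set.mem_Iic, Pi.one_apply]
    rcases lt_trichotomy u t with h | h | h
    · rw [if_pos (by linarith), if_pos h, if_pos h.le]; norm_num
    · subst h; norm_num
    · rw [if_neg (by linarith), if_neg (by intro h2; linarith), if_neg (by linarith),
        if_neg (by linarith)]; norm_num
  simp_rw [h1]
  rw [integral_div, integral_add ((integrable_const 1).indicator measurableSet_Iio)
    ((integrable_const 1).indicator measurableSet_Iic), integral_indicator_one measurableSet_Iio,
    integral_indicator_one measurableSet_Iic]
  rfl

theorem integrable_of_measurable_of_abs_le {Ω : Type*} [MeasurableSpace Ω] {P : Measure Ω}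
    [IsFiniteMeasure P] {f : Ω → ℝ} (hf : Measurable f) {C : ℝ} (hC : ∀ ω, |f ω| ≤ C) :
    Integrable f P :=
  Integrable.of_bound hf.aestronglyMeasurable C (ae_of_all _ hC)

section moments

variable {Ω : Type*} [MeasurableSpace Ω] {P : Measure Ω} [IsProbabilityMeasure P]
  {κ E : Type*} [MeasurableSpace E] {Y : κ → Ω → E}

/-- `Y t` is independent of the pair `(Y s₀, Y s)`, so it is integrated out first. The case `s = s₀`
is allowed. -/
theorem integral_mul_eq_zero_of_iIndepFun (hYm : ∀ s, Measurable (Y s)) (hY : iIndepFun Y P)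
    {g : E → E → ℝ} (hg : Measurable (Function.uncurry g)) (hg1 : ∀ y z, |g y z| ≤ 1) {s₀ s t : κ}
    (h0 : ∀ y, ∫ ω, g y (Y t ω) ∂P = 0) (hs : s ≠ t) (hs₀ : s₀ ≠ t) :
    ∫ ω, g (Y s₀ ω) (Y s ω) * g (Y s₀ ω) (Y t ω) ∂P = 0 := by
  have h1 := (hY.indepFun_prodMk hYm s₀ s t hs₀ hs)
  have h2 := (indepFun_iff_map_prod_eq_prod_map_map (by fun_prop) (by fun_prop)).1 h1
  have hf : Measurable fun q : (E × E) × E => g q.1.1 q.1.2 * g q.1.1 q.2 := by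
    have e1 : Measurable fun q : (E × E) × E => g q.1.1 q.1.2 := hg.comp measurable_fst
    have e2 : Measurable fun q : (E × E) × E => g q.1.1 q.2 :=
      hg.comp ((measurable_fst.comp measurable_fst).prodMk measurable_snd)
    exact e1.mul e2
  have hfb : ∀ q : (E × E) × E, |g q.1.1 q.1.2 * g q.1.1 q.2| ≤ 1 := fun q => by
    rw [abs_mul]; exact mul_le_one₀ (hg1 _ _) (abs_nonneg _) (hg1 _ _)
  have := Measure.isProbabilityMeasure_map (μ := P) ((hYm s₀).prodMk (hYm s)).aemeasurable
  have := Measure.isProbabilityMeasure_map (μ := P) (hYm t).aemeasurable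
  have h3 : ∫ ω, g (Y s₀ ω) (Y s ω) * g (Y s₀ ω) (Y t ω) ∂P
      = ∫ q, g q.1.1 q.1.2 * g q.1.1 q.2 ∂(P.map fun ω => ((Y s₀ ω, Y s ω), Y t ω)) :=
    (integral_map (((hYm s₀).prodMk (hYm s)).prodMk (hYm t)).aemeasurable
      hf.aestronglyMeasurable).symm
  rw [h3, h2, integral_prod _ (integrable_of_measurable_of_abs_le hf hfb)]
  refine integral_eq_zero_of_ae (ae_of_all _ fun q => ?_)
  simp only [Pi.zero_apply]
  have hgq : Measurable (g q.1) := hg.comp (measurable_const.prodMk measurable_id)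
  rw [integral_const_mul, integral_map (hYm t).aemeasurable hgq.aestronglyMeasurable, h0,
    mul_zero]

/-- The evaluation point `Y s₀` may belong to the sample itself. The only cross terms that may
survive have `s = t` or `t = s₀`, at most `2 * J.card` in number and each bounded by 1. -/
theorem integral_sum_sq_le (hYm : ∀ s, Measurable (Y s)) (hY : iIndepFun Y P)
    {g : E → E → ℝ} (hg : Measurable (Function.uncurry g)) (hg1 : ∀ y z, |g y z| ≤ 1) (s₀ : κ)
    (J : Finset κ) (h0 : ∀ t ∈ J, ∀ y, ∫ ω, g y (Y t ω) ∂P = 0) :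
    ∫ ω, (∑ s ∈ J, g (Y s₀ ω) (Y s ω)) ^ 2 ∂P ≤ 2 * J.card := by
  classical
  have hm : ∀ s, Measurable fun ω => g (Y s₀ ω) (Y s ω) := fun s =>
    hg.comp ((hYm s₀).prodMk (hYm s))
  have hb : ∀ s t ω, |g (Y s₀ ω) (Y s ω) * g (Y s₀ ω) (Y t ω)| ≤ 1 := fun s t ω => by
    rw [abs_mul]; exact mul_le_one₀ (hg1 _ _) (abs_nonneg _) (hg1 _ _)
  have hi : ∀ s t, Integrable (fun ω => g (Y s₀ ω) (Y s ω) * g (Y s₀ ω) (Y t ω)) P := fun s t =>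
    integrable_of_measurable_of_abs_le ((hm s).mul (hm t)) (hb s t)
  have h1 : ∀ s ∈ J, ∀ t ∈ J, ∫ ω, g (Y s₀ ω) (Y s ω) * g (Y s₀ ω) (Y t ω) ∂P
      ≤ (if s = t then 1 else 0) + (if s₀ = t then 1 else 0) := by
    intro s _ t ht
    have h2 : ∫ ω, g (Y s₀ ω) (Y s ω) * g (Y s₀ ω) (Y t ω) ∂P ≤ 1 := by
      calc _ ≤ ∫ _, (1 : ℝ) ∂P := integral_mono (hi s t) (integrable_const _)
            fun ω => (le_abs_self _).trans (hb s t ω)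
        _ = 1 := by simp
    by_cases hs : s = t
    · rw [if_pos hs]; split_ifs <;> linarith
    · by_cases hs₀ : s₀ = t
      · rw [if_neg hs, if_pos hs₀]; linarith
      · rw [if_neg hs, if_neg hs₀, integral_mul_eq_zero_of_iIndepFun hYm hY hg hg1 (h0 t ht) hs hs₀]
        simp
  simp_rw [sq, Finset.sum_mul_sum]
  rw [integral_finsetSum _ fun s _ => integrable_finsetSum _ fun t _ => hi s t]
  simp_rw [integral_finsetSum _ fun t _ => hi _ t]
  calc _ ≤ ∑ s ∈ J, ∑ t ∈ J, (((if s = t then 1 else 0) + (if s₀ = t then 1 else 0) : ℝ)) :=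
        Finset.sum_le_sum fun s hs => Finset.sum_le_sum fun t ht => h1 s hs t ht
    _ ≤ ∑ s ∈ J, (2 : ℝ) := by
        refine Finset.sum_le_sum fun s hs => ?_
        rw [Finset.sum_add_distrib, Finset.sum_ite_eq, Finset.sum_ite_eq]
        split_ifs <;> norm_num
    _ = 2 * J.card := by simp [mul_comm]

end moments

section empirical

variable {Ω : Type*} [MeasurableSpace Ω] {P : Measure Ω} [IsProbabilityMeasure P]
  {X : Fin a → ℕ → Ω → Fin d → ℝ}

theorem integral_average_sq_le (hXm : ∀ i k, Measurable (X i k))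
    (hXind : iIndepFun (fun s : Fin a × ℕ => X s.1 s.2) P) {g : (Fin d → ℝ) → (Fin d → ℝ) → ℝ}
    (hg : Measurable (Function.uncurry g)) (hg1 : ∀ y z, |g y z| ≤ 1) (s₀ : Fin a × ℕ)
    (i : Fin a) (h0 : ∀ k y, ∫ ω, g y (X i k ω) ∂P = 0) (N : ℕ) :
    ∫ ω, ((1 / (N : ℝ)) * ∑ k ∈ Finset.range N, g (X s₀.1 s₀.2 ω) (X i k ω)) ^ 2 ∂P
      ≤ (2 : ℝ) / N := by
  have h1 := integral_sum_sq_le (fun s : Fin a × ℕ => hXm s.1 s.2) hXind hg hg1 s₀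
    ((Finset.range N).map (Function.Embedding.sectR i ℕ)) (by
      intro t ht y
      obtain ⟨k, -, rfl⟩ := Finset.mem_map.1 ht
      exact h0 k y)
  simp only [Finset.sum_map, Finset.card_map, Finset.card_range,
    Function.Embedding.sectR_apply] at h1
  simp_rw [mul_pow]
  rw [integral_const_mul]
  rcases Nat.eq_zero_or_pos N with rfl | hN
  · simp
  · have hN' : (0 : ℝ) < N := Nat.cast_pos.2 hN
    calc _ ≤ (1 / (N : ℝ)) ^ 2 * (2 * N) := by gcongr
      _ = 2 / N := by field_simp

theorem margCDF_eq_integral (hXm : ∀ i k, Measurable (X i k))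
    (hXid : ∀ i k, IdentDistrib (X i k) (X i 0) P P) (i : Fin a) (j : Fin d) (k : ℕ) (t : ℝ) :
    margCDF (fun i => P.map (X i 0)) i j t = ∫ ω, c (t - X i k ω j) ∂P := by
  have h1 : Measurable fun y : Fin d → ℝ => y j := measurable_pi_apply j
  unfold margCDF
  have := Measure.isProbabilityMeasure_map (μ := P) (hXm i 0).aemeasurable
  have := Measure.isProbabilityMeasure_map (μ := P.map (X i 0)) h1.aemeasurable
  beta_reduce
  rw [normalizedCDF_eq_integral, ← (hXid i k).map_eq, Measure.map_map h1 (hXm i k),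
    integral_map (h1.comp (hXm i k)).aemeasurable
    (Measurable.aestronglyMeasurable (by fun_prop))]
  rfl

theorem abs_sub_le_one_of_mem_Icc {s t : ℝ} (hs : s ∈ Set.Icc (0 : ℝ) 1)
    (ht : t ∈ Set.Icc (0 : ℝ) 1) : |s - t| ≤ 1 := by
  rw [abs_le]; constructor <;> linarith [hs.1, hs.2, ht.1, ht.2]

/-- For each fixed `y`, `c (y j - z j) - F_{ij}(y j)` is centered when `z` has the law of group `i`.
The evaluation point can thus be another observation, even one used in `F̂_{ij}`. -/
theorem integral_empCDF_sub_sq_le (hXm : ∀ i k, Measurable (X i k))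
    (hXind : iIndepFun (fun s : Fin a × ℕ => X s.1 s.2) P)
    (hXid : ∀ i k, IdentDistrib (X i k) (X i 0) P P) {n : Fin a → ℕ} (r : Fin a) (k : ℕ)
    (i : Fin a) (j : Fin d) (hn : n i ≠ 0) :
    ∫ ω, (empCDF n (fun i k => X i k ω) i j (X r k ω j)
      - margCDF (fun i => P.map (X i 0)) i j (X r k ω j)) ^ 2 ∂P ≤ 2 / n i := by
  have hQ : ∀ i, IsProbabilityMeasure (P.map (X i 0)) := fun i =>
    Measure.isProbabilityMeasure_map (hXm i 0).aemeasurable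
  have hF := margCDF_mem_Icc (fun i => P.map (X i 0)) i j
  have h1 := integral_average_sq_le (P := P) hXm hXind
    (g := fun y z => c (y j - z j) - margCDF (fun i => P.map (X i 0)) i j (y j))
    (by unfold Function.uncurry; fun_prop)
    (fun y z => abs_sub_le_one_of_mem_Icc ⟨c_nonneg _, c_le_one _⟩ (hF _)) (r, k) i
    (fun k' y => by
      rw [integral_sub (integrable_of_measurable_of_abs_le (C := 1) (by fun_prop) fun ω => by
        rw [abs_of_nonneg (c_nonneg _)]; exact c_le_one _) (integrable_const _),
        ← margCDF_eq_integral hXm hXid]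
      simp) (n i)
  refine le_of_eq_of_le (integral_congr_ae (ae_of_all _ fun ω => ?_)) h1
  have : (n i : ℝ) ≠ 0 := Nat.cast_ne_zero.2 hn
  simp only [empCDF, Finset.sum_sub_distrib, mul_sub]
  simp [this]

/-- The error splits into replacing `G k` by `H (X r k)`, costing `B` by Cauchy–Schwarz, and the law
of large numbers for `H`, costing `2 / N`. Both are doubled by `(x + y)² ≤ 2x² + 2y²`. -/
theorem integral_average_sub_sq_le (hXm : ∀ i k, Measurable (X i k))
    (hXind : iIndepFun (fun s : Fin a × ℕ => X s.1 s.2) P)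
    (hXid : ∀ i k, IdentDistrib (X i k) (X i 0) P P) (r : Fin a) {N : ℕ} (hN : N ≠ 0)
    {G : ℕ → Ω → ℝ} (hGm : ∀ k, Measurable (G k)) (hG : ∀ k ω, G k ω ∈ Set.Icc (0 : ℝ) 1)
    {H : (Fin d → ℝ) → ℝ} (hHm : Measurable H) (hH : ∀ y, H y ∈ Set.Icc (0 : ℝ) 1) {B : ℝ}
    (hB : ∀ k, ∫ ω, (G k ω - H (X r k ω)) ^ 2 ∂P ≤ B) :
    ∫ ω, ((1 / (N : ℝ)) * ∑ k ∈ Finset.range N, G k ω - ∫ y, H y ∂(P.map (X r 0))) ^ 2 ∂P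
      ≤ 2 * B + 4 / N := by
  have hN' : (0 : ℝ) < N := Nat.cast_pos.2 (Nat.pos_of_ne_zero hN)
  set μ := ∫ y, H y ∂(P.map (X r 0)) with hμ
  have hμk : ∀ k, ∫ ω, H (X r k ω) ∂P = μ := fun k => by
    rw [hμ, ← (hXid r k).map_eq, integral_map (hXm r k).aemeasurable hHm.aestronglyMeasurable]
  have hHi : ∀ k, Integrable (fun ω => H (X r k ω)) P := fun k =>
    integrable_of_measurable_of_abs_le (C := 1) (hHm.comp (hXm r k)) fun ω => by
      rw [abs_of_nonneg (hH _).1]; exact (hH _).2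
  have hμ1 : μ ∈ Set.Icc (0 : ℝ) 1 := by
    rw [← hμk 0]
    refine ⟨integral_nonneg fun ω => (hH _).1, ?_⟩
    calc _ ≤ ∫ _, (1 : ℝ) ∂P := integral_mono (hHi 0) (integrable_const _) fun ω => (hH _).2
      _ = 1 := by simp
  -- This `g` ignores its first argument, so the base index `(r, 0)` is arbitrary.
  have h1 := integral_average_sq_le (P := P) hXm hXind (g := fun _ z => H z - μ)
    (by unfold Function.uncurry; fun_prop)
    (fun y z => abs_sub_le_one_of_mem_Icc (hH _) hμ1) (r, 0) r
    (fun k y => by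
      rw [integral_sub (hHi k) (integrable_const _), hμk]; simp) N
  have hHmk : ∀ k, Measurable fun ω => H (X r k ω) := fun k => hHm.comp (hXm r k)
  have hsq : ∀ k, Integrable (fun ω => (G k ω - H (X r k ω)) ^ 2) P := fun k =>
    integrable_of_measurable_of_abs_le (C := 1) (by fun_prop) fun ω => by
      rw [abs_pow]
      exact pow_le_one₀ (abs_nonneg _) (abs_sub_le_one_of_mem_Icc (hG _ _) (hH _))
  have hav : ∀ ω, (1 / (N : ℝ)) * ∑ k ∈ Finset.range N, G k ω ∈ Set.Icc (0 : ℝ) 1 := fun ω =>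
    average_mem_Icc _ _ fun k => hG k ω
  have hHav : ∀ ω, (1 / (N : ℝ)) * ∑ k ∈ Finset.range N, (H (X r k ω) - μ)
      = (1 / (N : ℝ)) * ∑ k ∈ Finset.range N, H (X r k ω) - μ := fun ω => by
    rw [Finset.sum_sub_distrib, mul_sub]; simp [hN]
  have hsq2 : Integrable (fun ω => ((1 / (N : ℝ)) * ∑ k ∈ Finset.range N, (H (X r k ω) - μ)) ^ 2)
      P := integrable_of_measurable_of_abs_le (C := 1) (by fun_prop) fun ω => by
    rw [abs_pow, hHav]
    exact pow_le_one₀ (abs_nonneg _) (abs_sub_le_one_of_mem_Icc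
      (average_mem_Icc _ _ fun k => hH _) hμ1)
  have hpt : ∀ ω, ((1 / (N : ℝ)) * ∑ k ∈ Finset.range N, G k ω - μ) ^ 2
      ≤ 2 * ((1 / (N : ℝ)) * ∑ k ∈ Finset.range N, (G k ω - H (X r k ω)) ^ 2)
        + 2 * ((1 / (N : ℝ)) * ∑ k ∈ Finset.range N, (H (X r k ω) - μ)) ^ 2 := by
    intro ω
    have e1 := sq_sum_le_card_mul_sum_sq (s := Finset.range N)
      (f := fun k => G k ω - H (X r k ω))
    rw [Finset.card_range] at e1
    have e2 : ((1 / (N : ℝ)) * ∑ k ∈ Finset.range N, (G k ω - H (X r k ω))) ^ 2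
        ≤ (1 / (N : ℝ)) * ∑ k ∈ Finset.range N, (G k ω - H (X r k ω)) ^ 2 := by
      rw [mul_pow]
      calc _ ≤ (1 / (N : ℝ)) ^ 2 * (N * ∑ k ∈ Finset.range N, (G k ω - H (X r k ω)) ^ 2) := by
            gcongr
        _ = _ := by field_simp
    have e3 : (1 / (N : ℝ)) * ∑ k ∈ Finset.range N, G k ω - μ
        = (1 / (N : ℝ)) * ∑ k ∈ Finset.range N, (G k ω - H (X r k ω))
          + (1 / (N : ℝ)) * ∑ k ∈ Finset.range N, (H (X r k ω) - μ) := by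
      rw [hHav, Finset.sum_sub_distrib]; ring
    rw [e3]
    nlinarith [sq_nonneg ((1 / (N : ℝ)) * ∑ k ∈ Finset.range N, (G k ω - H (X r k ω))
          - (1 / (N : ℝ)) * ∑ k ∈ Finset.range N, (H (X r k ω) - μ))]
  have hi1 : Integrable (fun ω => 2 * ((1 / (N : ℝ)) * ∑ k ∈ Finset.range N,
      (G k ω - H (X r k ω)) ^ 2)) P :=
    ((integrable_finsetSum _ fun k _ => hsq k).const_mul _).const_mul _
  calc _ ≤ ∫ ω, (2 * ((1 / (N : ℝ)) * ∑ k ∈ Finset.range N, (G k ω - H (X r k ω)) ^ 2)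
        + 2 * ((1 / (N : ℝ)) * ∑ k ∈ Finset.range N, (H (X r k ω) - μ)) ^ 2) ∂P := by
        refine integral_mono (integrable_of_measurable_of_abs_le (C := 1) (by fun_prop) fun ω => ?_)
          (hi1.add (hsq2.const_mul 2)) hpt
        rw [abs_pow]
        exact pow_le_one₀ (abs_nonneg _) (abs_sub_le_one_of_mem_Icc (hav ω) hμ1)
    _ = 2 * ((1 / (N : ℝ)) * ∑ k ∈ Finset.range N, ∫ ω, (G k ω - H (X r k ω)) ^ 2 ∂P)
        + 2 * ∫ ω, ((1 / (N : ℝ)) * ∑ k ∈ Finset.range N, (H (X r k ω) - μ)) ^ 2 ∂P := by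
        rw [integral_add hi1 (hsq2.const_mul 2), integral_const_mul, integral_const_mul,
          integral_const_mul, integral_finsetSum _ fun k _ => hsq k]
    _ ≤ 2 * ((1 / (N : ℝ)) * ∑ k ∈ Finset.range N, B) + 2 * (2 / N) := by
        gcongr with k _
        · exact hB k
    _ = 2 * B + 4 / N := by
        simp only [Finset.sum_const, Finset.card_range, nsmul_eq_mul]
        field_simp
        ring

end empirical

/-! ### Convergence in probability of the empirical moments -/

section moments

variable {Ω : Type*} [MeasurableSpace Ω] {P : Measure Ω} [IsProbabilityMeasure P]

theorem tendsto_measure_abs_ge {Z : ℕ → Ω → ℝ} (hZm : ∀ m, Measurable (Z m))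
    (hZ : ∀ m ω, |Z m ω| ≤ 1) {b : ℕ → ℝ} (hb : Tendsto b atTop (𝓝 0))
    (hZb : ∀ᶠ m in atTop, ∫ ω, Z m ω ^ 2 ∂P ≤ b m) {δ : ℝ} (hδ : 0 < δ) :
    Tendsto (fun m => P {ω | δ ≤ |Z m ω|}) atTop (𝓝 0) := by
  have h1 : ∀ᶠ m in atTop, P {ω | δ ≤ |Z m ω|} ≤ ENNReal.ofReal (b m / δ ^ 2) := by
    filter_upwards [hZb] with m hm
    have h2 := mul_meas_ge_le_integral_of_nonneg (μ := P) (f := fun ω => Z m ω ^ 2)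
      (ae_of_all _ fun ω => sq_nonneg _)
      (integrable_of_measurable_of_abs_le (C := 1) (by fun_prop) fun ω => by
        rw [abs_pow]; exact pow_le_one₀ (abs_nonneg _) (hZ m ω)) (δ ^ 2)
    have h3 : {ω | δ ^ 2 ≤ Z m ω ^ 2} = {ω | δ ≤ |Z m ω|} := by
      ext ω
      simp only [Set.mem_ofPred_eq]
      rw [sq_le_sq, abs_of_pos hδ]
    rw [h3] at h2
    rw [ENNReal.le_ofReal_iff_toReal_le (measure_ne_top _ _)
      (div_nonneg ((integral_nonneg fun ω => sq_nonneg _).trans hm) (sq_nonneg _)),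
      le_div_iff₀ (by positivity), mul_comm]
    exact h2.trans hm
  have h4 : Tendsto (fun m => ENNReal.ofReal (b m / δ ^ 2)) atTop (𝓝 0) := by
    have := ENNReal.tendsto_ofReal (hb.div_const (δ ^ 2))
    simpa using this
  exact tendsto_of_tendsto_of_tendsto_of_le_of_le' tendsto_const_nhds h4
    (Eventually.of_forall fun _ => zero_le) h1

variable {X : Fin a → ℕ → Ω → Fin d → ℝ}

theorem measurable_empCDF {α : Type*} [MeasurableSpace α] (n : Fin a → ℕ)
    {x : Fin a → ℕ → α → Fin d → ℝ} (hx : ∀ i k j, Measurable fun q => x i k q j) {t : α → ℝ}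
    (ht : Measurable t) (i : Fin a) (j : Fin d) :
    Measurable fun q => empCDF n (fun i k => x i k q) i j (t q) := by
  unfold empCDF
  fun_prop

theorem tendsto_measure_empInt (hXm : ∀ i k, Measurable (X i k))
    (hXind : iIndepFun (fun s : Fin a × ℕ => X s.1 s.2) P)
    (hXid : ∀ i k, IdentDistrib (X i k) (X i 0) P P) {n : ℕ → Fin a → ℕ}
    (hn : ∀ i, Tendsto (fun m => (n m i : ℝ)) atTop atTop) (r i : Fin a) (j : Fin d) {δ : ℝ}
    (hδ : 0 < δ) :
    Tendsto (fun m => P {ω | δ ≤ |empInt (n m) (fun i k => X i k ω) r j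
      (empCDF (n m) (fun i k => X i k ω) i j)
        - ∫ y, margCDF (fun i => P.map (X i 0)) i j (y j) ∂P.map (X r 0)|}) atTop (𝓝 0) := by
  have hQ : ∀ i, IsProbabilityMeasure (P.map (X i 0)) := fun i =>
    Measure.isProbabilityMeasure_map (hXm i 0).aemeasurable
  have hXc : ∀ i k j, Measurable fun ω => X i k ω j := fun i k j =>
    (measurable_pi_apply j).comp (hXm i k)
  have hF := margCDF_mem_Icc (fun i => P.map (X i 0))
  have hlim : Tendsto (fun m => 2 * (2 / (n m i : ℝ)) + 4 / (n m r : ℝ)) atTop (𝓝 0) := by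
    have h := (((hn i).const_div_atTop 2).const_mul 2).add ((hn r).const_div_atTop 4)
    simpa using h
  refine tendsto_measure_abs_ge (fun m => ?_) (fun m ω => ?_) hlim ?_ hδ
  · have h := fun k => measurable_empCDF (n m) hXc (hXc r k j) i j
    unfold empInt
    fun_prop
  · refine abs_sub_le_one_of_mem_Icc (average_mem_Icc _ _ fun k => empCDF_mem_Icc _ _ _ _ _)
      ⟨integral_nonneg fun y => (hF i j _).1, ?_⟩
    calc _ ≤ ∫ _, (1 : ℝ) ∂P.map (X r 0) :=
          integral_mono ((memLp_margCDF _ r i j).integrable one_le_two) (integrable_const _)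
            fun y => (hF i j _).2
      _ = 1 := by simp
  · filter_upwards [(hn i).eventually_gt_atTop 0, (hn r).eventually_gt_atTop 0] with m hi hr
    have hi' : n m i ≠ 0 := by rintro h; simp [h] at hi
    have hr' : n m r ≠ 0 := by rintro h; simp [h] at hr
    exact integral_average_sub_sq_le hXm hXind hXid r hr'
      (fun k => measurable_empCDF (n m) hXc (hXc r k j) i j)
      (fun k ω => empCDF_mem_Icc _ _ _ _ _) (by fun_prop) (fun y => hF i j _)
      fun k => integral_empCDF_sub_sq_le hXm hXind hXid r k i j hi'

theorem mul_mem_Icc_zero_one {s t : ℝ} (hs : s ∈ Set.Icc (0 : ℝ) 1) (ht : t ∈ Set.Icc (0 : ℝ) 1) :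
    s * t ∈ Set.Icc (0 : ℝ) 1 :=
  ⟨mul_nonneg hs.1 ht.1, mul_le_one₀ hs.2 ht.1 ht.2⟩

theorem mul_sub_mul_sq_le {s t s' t' : ℝ} (hs : s ∈ Set.Icc (0 : ℝ) 1)
    (ht' : t' ∈ Set.Icc (0 : ℝ) 1) :
    (s * t - s' * t') ^ 2 ≤ 2 * (s - s') ^ 2 + 2 * (t - t') ^ 2 := by
  have h1 : s * t - s' * t' = s * (t - t') + t' * (s - s') := by ring
  have h2 : s ^ 2 ≤ 1 := pow_le_one₀ hs.1 hs.2
  have h3 : t' ^ 2 ≤ 1 := pow_le_one₀ ht'.1 ht'.2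
  have h4 : s ^ 2 * (t - t') ^ 2 ≤ 1 * (t - t') ^ 2 := by gcongr
  have h5 : t' ^ 2 * (s - s') ^ 2 ≤ 1 * (s - s') ^ 2 := by gcongr
  rw [h1]
  linarith [sq_nonneg (s * (t - t') - t' * (s - s'))]

/-- `mul_sub_mul_sq_le` reduces the error of a product of two empirical distribution functions to
the errors of its factors; Chebyshev's inequality then applies. -/
theorem tendsto_measure_empMixed (hXm : ∀ i k, Measurable (X i k))
    (hXind : iIndepFun (fun s : Fin a × ℕ => X s.1 s.2) P)
    (hXid : ∀ i k, IdentDistrib (X i k) (X i 0) P P) {n : ℕ → Fin a → ℕ}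
    (hn : ∀ i, Tendsto (fun m => (n m i : ℝ)) atTop atTop) (r i : Fin a) (j : Fin d) (i' : Fin a)
    (j' : Fin d) {δ : ℝ} (hδ : 0 < δ) :
    Tendsto (fun m => P {ω | δ ≤ |empMixed (n m) (fun i k => X i k ω) r i j i' j'
        - ∫ y, margCDF (fun i => P.map (X i 0)) i j (y j)
          * margCDF (fun i => P.map (X i 0)) i' j' (y j') ∂P.map (X r 0)|}) atTop (𝓝 0) := by
  have hQ : ∀ i, IsProbabilityMeasure (P.map (X i 0)) := fun i =>
    Measure.isProbabilityMeasure_map (hXm i 0).aemeasurable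
  have hXc : ∀ i k j, Measurable fun ω => X i k ω j := fun i k j =>
    (measurable_pi_apply j).comp (hXm i k)
  have hF := margCDF_mem_Icc (fun i => P.map (X i 0))
  have hFm : ∀ i j, Measurable (margCDF (fun i => P.map (X i 0)) i j) := fun i j =>
    measurable_margCDF _ i j
  have hG : ∀ m k, Measurable fun ω => empCDF (n m) (fun i k => X i k ω) i j (X r k ω j)
      * empCDF (n m) (fun i k => X i k ω) i' j' (X r k ω j') := fun m k =>
    (measurable_empCDF (n m) hXc (hXc r k j) i j).mul
      (measurable_empCDF (n m) hXc (hXc r k j') i' j')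
  have hlim : Tendsto (fun m => 2 * (2 * (2 / (n m i : ℝ)) + 2 * (2 / (n m i' : ℝ)))
      + 4 / (n m r : ℝ)) atTop (𝓝 0) := by
    have h := (((((hn i).const_div_atTop 2).const_mul 2).add
      (((hn i').const_div_atTop 2).const_mul 2)).const_mul 2).add ((hn r).const_div_atTop 4)
    simpa using h
  refine tendsto_measure_abs_ge (fun m => ?_) (fun m ω => ?_) hlim ?_ hδ
  · have h := hG m
    unfold empMixed
    fun_prop
  · refine abs_sub_le_one_of_mem_Icc (average_mem_Icc _ _ fun k => mul_mem_Icc_zero_one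
      (empCDF_mem_Icc _ _ _ _ _) (empCDF_mem_Icc _ _ _ _ _))
      ⟨integral_nonneg fun y => (mul_mem_Icc_zero_one (hF i j _) (hF i' j' _)).1, ?_⟩
    calc _ ≤ ∫ _, (1 : ℝ) ∂P.map (X r 0) :=
          integral_mono ((memLp_margCDF _ r i j).integrable_mul (memLp_margCDF _ r i' j'))
            (integrable_const _) fun y => (mul_mem_Icc_zero_one (hF i j _) (hF i' j' _)).2
      _ = 1 := by simp
  · filter_upwards [(hn i).eventually_gt_atTop 0, (hn i').eventually_gt_atTop 0,
      (hn r).eventually_gt_atTop 0] with m hi hi2 hr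
    have hi' : n m i ≠ 0 := by rintro h; simp [h] at hi
    have hi2' : n m i' ≠ 0 := by rintro h; simp [h] at hi2
    have hr' : n m r ≠ 0 := by rintro h; simp [h] at hr
    refine integral_average_sub_sq_le hXm hXind hXid r hr' (hG m)
      (fun k ω => mul_mem_Icc_zero_one (empCDF_mem_Icc _ _ _ _ _) (empCDF_mem_Icc _ _ _ _ _))
      (H := fun y => margCDF (fun i => P.map (X i 0)) i j (y j)
          * margCDF (fun i => P.map (X i 0)) i' j' (y j')) (by fun_prop)
      (fun y => mul_mem_Icc_zero_one (hF i j _) (hF i' j' _)) fun k => ?_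
    have hsq : ∀ i j, Integrable (fun ω => (empCDF (n m) (fun i k => X i k ω) i j (X r k ω j)
        - margCDF (fun i => P.map (X i 0)) i j (X r k ω j)) ^ 2) P := fun i j => by
      have h := measurable_empCDF (n m) hXc (hXc r k j) i j
      refine integrable_of_measurable_of_abs_le (C := 1) (by fun_prop) fun ω => ?_
      rw [abs_pow]
      exact pow_le_one₀ (abs_nonneg _)
        (abs_sub_le_one_of_mem_Icc (empCDF_mem_Icc _ _ _ _ _) (hF _ _ _))
    have hm := hG m k
    calc _ ≤ ∫ ω, (2 * (empCDF (n m) (fun i k => X i k ω) i j (X r k ω j)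
          - margCDF (fun i => P.map (X i 0)) i j (X r k ω j)) ^ 2
          + 2 * (empCDF (n m) (fun i k => X i k ω) i' j' (X r k ω j')
          - margCDF (fun i => P.map (X i 0)) i' j' (X r k ω j')) ^ 2) ∂P := by
          refine integral_mono (integrable_of_measurable_of_abs_le (C := 1) (by fun_prop)
            fun ω => ?_) (((hsq i j).const_mul 2).add ((hsq i' j').const_mul 2))
            fun ω => mul_sub_mul_sq_le (empCDF_mem_Icc _ _ _ _ _) (hF _ _ _)
          rw [abs_pow]
          exact pow_le_one₀ (abs_nonneg _) (abs_sub_le_one_of_mem_Icc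
            (mul_mem_Icc_zero_one (empCDF_mem_Icc _ _ _ _ _) (empCDF_mem_Icc _ _ _ _ _))
            (mul_mem_Icc_zero_one (hF _ _ _) (hF _ _ _)))
      _ = _ := by
          rw [integral_add ((hsq i j).const_mul 2) ((hsq i' j').const_mul 2), integral_const_mul,
            integral_const_mul]
      _ ≤ _ := by
          gcongr
          · exact integral_empCDF_sub_sq_le hXm hXind hXid r k i j hi'
          · exact integral_empCDF_sub_sq_le hXm hXind hXid r k i' j' hi2'

end moments

/-! ### The conditional law of the bootstrap statistic -/

section congr

variable {n : Fin a → ℕ} {x x' : Fin a → ℕ → Fin d → ℝ}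

theorem empCDF_congr (h : ∀ i, ∀ k < n i, x i k = x' i k) : empCDF n x = empCDF n x' := by
  funext i j t
  unfold empCDF
  congr 1
  exact Finset.sum_congr rfl fun k hk => by rw [h i k (Finset.mem_range.1 hk)]

theorem empInt_congr (h : ∀ i, ∀ k < n i, x i k = x' i k) : empInt n x = empInt n x' := by
  funext i j f
  unfold empInt
  congr 1
  exact Finset.sum_congr rfl fun k hk => by rw [h i k (Finset.mem_range.1 hk)]

theorem wildCDF_congr (h : ∀ i, ∀ k < n i, x i k = x' i k) (D : Fin a → ℕ → ℝ) :
    wildCDF n x D = wildCDF n x' D := by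
  funext l j t
  unfold wildCDF wildResid
  rw [empCDF_congr h]
  congr 1
  exact Finset.sum_congr rfl fun k hk => by rw [h l k (Finset.mem_range.1 hk)]

/-- Only individuals with `k < n i` enter, so the statistic factors through the pooled sample. -/
theorem wildATS_congr (h : ∀ i, ∀ k < n i, x i k = x' i k)
    (T : Matrix (Fin a × Fin d) (Fin a × Fin d) ℝ) (D : Fin a → ℕ → ℝ) :
    wildATS T n x D = wildATS T n x' D := by
  have h1 : wildMeanCDF n x D = wildMeanCDF n x' D := by
    unfold wildMeanCDF; rw [wildCDF_congr h]
  unfold wildATS pStar wildEffect empMeanInt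
  rw [h1, wildCDF_congr h, empInt_congr h]

end congr

theorem measurable_wildATS {α : Type*} [MeasurableSpace α]
    (T : Matrix (Fin a × Fin d) (Fin a × Fin d) ℝ) (n : Fin a → ℕ)
    {x : Fin a → ℕ → α → Fin d → ℝ} (hx : ∀ i k j, Measurable fun q => x i k q j)
    {D : Fin a → ℕ → α → ℝ} (hD : ∀ i k, Measurable (D i k)) :
    Measurable fun q => wildATS T n (fun i k => x i k q) fun i k => D i k q := by
  have h1 : ∀ l j {t : α → ℝ}, Measurable t →
      Measurable fun q => wildCDF n (fun i k => x i k q) (fun i k => D i k q) l j (t q) := by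
    intro l j t ht
    have h := measurable_empCDF n hx ht l j
    unfold wildCDF wildResid
    fun_prop
  have h2 : ∀ i i' k j, Measurable fun q =>
      wildCDF n (fun i k => x i k q) (fun i k => D i k q) i j (x i' k q j) := fun i i' k j =>
    h1 i j (hx i' k j)
  refine (continuous_quadForm T).measurable.comp (measurable_pi_lambda _ fun p => ?_)
  unfold pStar wildEffect empMeanInt empInt wildMeanCDF
  fun_prop

/-- Extension by zero of the pooled sample to all individuals. -/
noncomputable def unpool (n : Fin a → ℕ) (y : ((i : Fin a) × Fin (n i)) → Fin d → ℝ) (i : Fin a)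
    (k : ℕ) : Fin d → ℝ :=
  if h : k < n i then y ⟨i, ⟨k, h⟩⟩ else 0

theorem measurable_unpool (n : Fin a → ℕ) (i : Fin a) (k : ℕ) (j : Fin d) :
    Measurable fun y => unpool n y i k j := by
  unfold unpool
  split_ifs <;> fun_prop

/-- `unpool` turns the statistic into a measurable function of the pooled sample and the
multipliers, to which the freezing lemma applies. -/
theorem condDistrib_wildATS {Ω : Type*} [MeasurableSpace Ω] {P : Measure Ω}
    [IsProbabilityMeasure P] {X : Fin a → ℕ → Ω → Fin d → ℝ} (hXm : ∀ i k, Measurable (X i k))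
    {D : Fin a → ℕ → Ω → ℝ} (hDm : ∀ i k, Measurable (D i k))
    (hXD : IndepFun (fun ω (s : Fin a × ℕ) => X s.1 s.2 ω)
      (fun ω (s : Fin a × ℕ) => D s.1 s.2 ω) P)
    (T : Matrix (Fin a × Fin d) (Fin a × Fin d) ℝ) (n : Fin a → ℕ) :
    ∀ᵐ ω ∂P, condDistrib (fun ω => wildATS T n (fun i k => X i k ω) fun i k => D i k ω)
        (fun ω => pooled n fun i k => X i k ω) P (pooled n fun i k => X i k ω)
      = P.map fun ω' => wildATS T n (fun i k => X i k ω) fun i k => D i k ω' := by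
  have hpool : ∀ ω (E : Fin a → ℕ → ℝ),
      wildATS T n (unpool n (pooled n fun i k => X i k ω)) E
        = wildATS T n (fun i k => X i k ω) E := fun ω E =>
    wildATS_congr (fun i k hk => by simp [unpool, pooled, hk]) T E
  have hXm' : Measurable fun ω => pooled n fun i k => X i k ω :=
    measurable_pi_lambda _ fun s => hXm _ _
  have hDm' : Measurable fun ω (s : Fin a × ℕ) => D s.1 s.2 ω :=
    measurable_pi_lambda _ fun s => hDm _ _
  have hind : IndepFun (fun ω => pooled n fun i k => X i k ω)
      (fun ω (s : Fin a × ℕ) => D s.1 s.2 ω) P := by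
    have hφ : Measurable fun (z : Fin a × ℕ → Fin d → ℝ) (s : (i : Fin a) × Fin (n i)) =>
        z (s.1, (s.2 : ℕ)) := measurable_pi_lambda _ fun s => measurable_pi_apply _
    exact hXD.comp hφ measurable_id
  have hf : Measurable fun q : (((i : Fin a) × Fin (n i)) → Fin d → ℝ) × (Fin a × ℕ → ℝ) =>
      wildATS T n (fun i k => unpool n q.1 i k) fun i k => q.2 (i, k) := by
    have h1 : ∀ i k j, Measurable fun q : (((i : Fin a) × Fin (n i)) → Fin d → ℝ) ×
        (Fin a × ℕ → ℝ) => unpool n q.1 i k j := fun i k j =>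
      (measurable_unpool n i k j).comp measurable_fst
    have h2 : ∀ i k, Measurable fun q : (((i : Fin a) × Fin (n i)) → Fin d → ℝ) ×
        (Fin a × ℕ → ℝ) => q.2 (i, k) := fun i k =>
      (measurable_pi_apply (i, k)).comp measurable_snd
    exact measurable_wildATS T n h1 h2
  filter_upwards [condDistrib_of_indepFun hXm' hDm' hind hf] with ω hω
  simpa only [hpool] using hω

end WildATS

theorem corollary2 {Ω : Type*} [MeasurableSpace Ω] (P : Measure Ω) [IsProbabilityMeasure P]
    (a d : ℕ)
    -- the observation vectors: independent, identically distributed within groups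
    (X : Fin a → ℕ → Ω → Fin d → ℝ)
    (hXm : ∀ i k, Measurable (X i k))
    (hXind : iIndepFun (fun s : Fin a × ℕ => X s.1 s.2) P)
    (hXid : ∀ i k, IdentDistrib (X i k) (X i 0) P P)
    -- the multipliers: i.i.d., centered, unit variance, tail condition, independent of the data
    (D : Fin a → ℕ → Ω → ℝ)
    (hDm : ∀ i k, Measurable (D i k))
    (hDind : iIndepFun (fun s : Fin a × ℕ => D s.1 s.2) P)
    (hDid : ∀ i k i' k', IdentDistrib (D i k) (D i' k') P P)
    (hDmean : ∀ i k, ∫ ω, D i k ω ∂P = 0)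
    (hDvar : ∀ i k, variance (D i k) P = 1)
    (hDtail : ∀ i k, IntegrableOn (fun t : ℝ => √(P.real {ω | t < |D i k ω|})) (Set.Ioi 0))
    (hXD : IndepFun (fun ω (s : Fin a × ℕ) => X s.1 s.2 ω) (fun ω (s : Fin a × ℕ) => D s.1 s.2 ω) P)
    -- the group sizes along the sequence of experiments, and the sample size condition
    (n : ℕ → Fin a → ℕ)
    (hN : Tendsto (fun m => WildATS.total (n m)) atTop atTop)
    (lam : Fin a → ℝ)
    (hlam : ∀ i, lam i ∈ Set.Ioo (0 : ℝ) 1)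
    (hn : ∀ i, Tendsto (fun m => (n m i : ℝ) / (WildATS.total (n m) : ℝ)) atTop (𝓝 (lam i)))
    -- the symmetric projection matrix
    (T : Matrix (Fin a × Fin d) (Fin a × Fin d) ℝ) (hTsymm : T.IsSymm) (hTidem : T * T = T) :
    let S := WildATS.asymCov (fun i => P.map (X i 0)) lam
    let ν := WildATS.weights S T hTsymm
    S.PosSemidef ∧ (∀ h, 0 ≤ ν h) ∧
    WildATS.gaussianQuadLaw S T = WildATS.weightedChiSqLaw ν ∧
    WildATS.CondTendstoInDistribution P
      (fun m ω => WildATS.wildATS T (n m) (fun i k => X i k ω) (fun i k => D i k ω))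
      (fun m ω => WildATS.pooled (n m) (fun i k => X i k ω))
      (WildATS.gaussianQuadLaw S T) := by
  intro S ν
  have hlam0 : ∀ i, 0 < lam i := fun i => (hlam i).1
  have hQ : ∀ i, IsProbabilityMeasure (P.map (X i 0)) := fun i =>
    Measure.isProbabilityMeasure_map (hXm i 0).aemeasurable
  refine ⟨WildATS.posSemidef_asymCov _ hlam0, WildATS.weights_nonneg S T hTsymm hTidem,
    WildATS.gaussianQuadLaw_eq_weightedChiSqLaw S T hTsymm, ?_⟩
  have hsize := WildATS.tendsto_size_atTop hN hlam0 hn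
  unfold WildATS.CondTendstoInDistribution
  rw [tendstoInMeasure_iff_norm]
  intro ε hε
  obtain ⟨δ, hδ, h1⟩ := WildATS.exists_blDist_wildATS_lt (fun i => P.map (X i 0)) hDm hDind hDid
    hDmean hDvar hN hlam0 hn T hε
  -- Almost surely, a distance of at least `ε` forces one of finitely many empirical moments to be
  -- off by at least `δ`. Only monotonicity and subadditivity of the outer measure are used, so the
  -- distance need not be measurable.
  have h2 : ∀ᶠ m in atTop, P {ω | ε ≤ ‖WildATS.blDist (condDistrib
        (fun ω => WildATS.wildATS T (n m) (fun i k => X i k ω) fun i k => D i k ω)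
        (fun ω => WildATS.pooled (n m) fun i k => X i k ω) P
        (WildATS.pooled (n m) fun i k => X i k ω)) (WildATS.gaussianQuadLaw S T) - 0‖}
      ≤ ∑ s : Fin a × Fin a × Fin d, P {ω | δ ≤ |WildATS.empInt (n m) (fun i k => X i k ω) s.1
          s.2.2 (WildATS.empCDF (n m) (fun i k => X i k ω) s.2.1 s.2.2)
          - ∫ y, WildATS.margCDF (fun i => P.map (X i 0)) s.2.1 s.2.2 (y s.2.2) ∂P.map (X s.1 0)|}
        + ∑ s : Fin a × (Fin a × Fin d) × (Fin a × Fin d),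
          P {ω | δ ≤ |WildATS.empMixed (n m) (fun i k => X i k ω) s.1 s.2.1.1 s.2.1.2 s.2.2.1
              s.2.2.2
            - ∫ y, WildATS.margCDF (fun i => P.map (X i 0)) s.2.1.1 s.2.1.2 (y s.2.1.2)
              * WildATS.margCDF (fun i => P.map (X i 0)) s.2.2.1 s.2.2.2 (y s.2.2.2)
                ∂P.map (X s.1 0)|} := by
    filter_upwards [h1] with m hm
    refine le_trans ?_ (add_le_add (measure_iUnion_fintype_le P _) (measure_iUnion_fintype_le P _))
    refine le_trans (measure_mono_ae ?_) (measure_union_le _ _)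
    filter_upwards [WildATS.condDistrib_wildATS hXm hDm hXD T (n m)] with ω hω hbad
    by_contra hgood
    refine absurd hbad (not_le.2 ?_)
    rw [hω, sub_zero, Real.norm_eq_abs, abs_of_nonneg (WildATS.blDist_nonneg _ _)]
    exact hm _
      (fun r i j => not_le.1 fun h => hgood (Or.inl (Set.mem_iUnion.2 ⟨(r, i, j), h⟩)))
      fun r i j i' j' => not_le.1 fun h =>
        hgood (Or.inr (Set.mem_iUnion.2 ⟨(r, (i, j), (i', j')), h⟩))
  refine tendsto_of_tendsto_of_tendsto_of_le_of_le' tendsto_const_nhds ?_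
    (Eventually.of_forall fun _ => zero_le) h2
  have h3 := (tendsto_finsetSum (Finset.univ : Finset (Fin a × Fin a × Fin d)) fun s _ =>
    WildATS.tendsto_measure_empInt hXm hXind hXid hsize s.1 s.2.1 s.2.2 hδ).add
    (tendsto_finsetSum (Finset.univ : Finset (Fin a × (Fin a × Fin d) × (Fin a × Fin d)))
      fun s _ => WildATS.tendsto_measure_empMixed hXm hXind hXid hsize s.1 s.2.1.1 s.2.1.2
        s.2.2.1 s.2.2.2 hδ)
  simpa using h3
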